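/- Let $n\ge 1$. A convex body in $\mathbb{R}^n$ is a compact convex set with the origin in its interior. For a convex body $T$ let $T^\circ=\{x:\langle x,y\rangle\le 1\ \forall y\in T\}$ be its polar, $\mu_{T^\circ}(x)=\min\{s\ge 0: x\in sT^\circ\}$ the Minkowski functional of $T^\circ$, and $N_T(z)=\{v:\langle v,y-z\rangle\le 0\ \forall y\in T\}$ the outer normal cone at $z\in\partial T$. A closed polygonal curve $q=(q_1,\dots,q_m)$ has $m\ge 2$ vertices in $\mathbb{R}^n$, indexed modulo $m$, such that for all $j$ one has $q_j\ne q_{j+1}$ and $q_j$ is not contained in the line segment joining $q_{j-1}$ and $q_{j+1}$. Its $\ell_T$-length is $\ell_T(q)=\sum_{j=1}^m\mu_{T^\circ}(q_{j+1}-q_j)$. For convex bodies $K,T\subset\mathbb{R}^n$, $q$ is a closed $(K,T)$-Minkowski billiard trajectory if $q_1,\dots,q_m\in\partial K$ and there are $p_1,\dots,p_m\in\partial T$ with $$q_{j+1}-q_j\in N_T(p_j),\qquad p_{j+1}-p_j\in -N_K(q_{j+1})\qquad\text{for all } j.$$ It is $\ell_T$-minimizing if $\ell_T(q)\le\ell_T(q')$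 for every closed $(K,T)$-Minkowski billiard trajectory $q'$ (with any number of vertices). Convergence of convex bodies, and of closed polygonal curves regarded as subsets of $\mathbb{R}^n$ (the unions of their edges), is with respect to the Hausdorff distance $d_H$. Theorem. (i) Let $T\subset\mathbb{R}^n$ be a strictly convex body, and let $(K_i)_{i\in\mathbb{N}}$ be a sequence of convex bodies in $\mathbb{R}^n$ that $d_H$-converges to a convex body $K\subset\mathbb{R}^n$. Then there are a strictly increasing sequence $(i_j)_{j\in\mathbb{N}}$ and a sequence $(q^{i_j})_{j\in\mathbb{N}}$ of $\ell_T$-minimizing closed $(K_{i_j},T)$-Minkowski billiard trajectories which $d_H$-converges to an $\ell_T$-minimizing closed $(K,T)$-Minkowski billiard trajectory. (ii) Let $K\subset\mathbb{R}^n$ be a convex body, and let $(T_i)_{i\in\mathbb{N}}$ be a sequence of strictly convex bodies in $\mathbb{R}^n$ that $d_H$-converges to a convex body $T\subset\mathbb{R}^n$. Then there are a strictly increasing sequence $(i_j)_{j\in\mathbb{N}}$ and a sequence $(q^{i_j})_{j\in\mathbb{N}}$ of $\ell_{T_{i_j}}$-minimizing closed $(K,T_{i_j})$-Minkowski billiard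 trajectories which $d_H$-converges to an $\ell_T$-minimizing closed $(K,T)$-Minkowski billiard trajectory. -/

import Mathlib

open Filter Topology

/-- A convex body: a compact convex subset of `ℝⁿ` with the origin in its interior. -/
structure IsBody {n : ℕ} (K : Set (EuclideanSpace ℝ (Fin n))) : Prop where
  convex : Convex ℝ K
  isCompact : IsCompact K
  zero_mem_interior : (0 : EuclideanSpace ℝ (Fin n)) ∈ interior K

/-- The (one-sided) polar body `T° = {x : ⟪x, y⟫ ≤ 1 for all y ∈ T}`. -/
def polarBody {n : ℕ} (T : Set (EuclideanSpace ℝ (Fin n))) : Set (EuclideanSpace ℝ (Fin n)) :=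
  {x | ∀ y ∈ T, inner ℝ x y ≤ 1}

/-- The outer normal cone `N_K(z) = {v : ⟪v, y - z⟫ ≤ 0 for all y ∈ K}`. -/
def normalCone {n : ℕ} (K : Set (EuclideanSpace ℝ (Fin n))) (z : EuclideanSpace ℝ (Fin n)) :
    Set (EuclideanSpace ℝ (Fin n)) :=
  {v | ∀ y ∈ K, inner ℝ v (y - z) ≤ 0}

/-- A closed polygonal curve with `m ≥ 2` vertices, the indices being taken modulo `m`.
Consecutive vertices are distinct, and no vertex lies on the line segment joining its
two neighbours. -/
structure ClosedPolygon (n : ℕ) where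
  m : ℕ
  two_le : 2 ≤ m
  vertex : ZMod m → EuclideanSpace ℝ (Fin n)
  vertex_ne : ∀ j, vertex j ≠ vertex (j + 1)
  vertex_notMem_segment : ∀ j, vertex j ∉ segment ℝ (vertex (j - 1)) (vertex (j + 1))

namespace ClosedPolygon

instance {n : ℕ} (q : ClosedPolygon n) : NeZero q.m := ⟨by have := q.two_le; omega⟩

/-- The curve as a subset of `ℝⁿ`: the union of its edges. -/
def trace {n : ℕ} (q : ClosedPolygon n) : Set (EuclideanSpace ℝ (Fin n)) :=
  ⋃ j, segment ℝ (q.vertex j) (q.vertex (j + 1))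

/-- The `ℓ_T`-length: the sum of the values of the Minkowski functional of `T°` on the edges. -/
noncomputable def length {n : ℕ} (T : Set (EuclideanSpace ℝ (Fin n))) (q : ClosedPolygon n) : ℝ :=
  ∑ j, gauge (polarBody T) (q.vertex (j + 1) - q.vertex j)

/-- `q` is a closed (strong) `(K, T)`-Minkowski billiard trajectory: its vertices `q_j` lie on
`∂K`, and there are points `p_j` on `∂T` with `q_{j+1} - q_j ∈ N_T(p_j)` and
`p_{j+1} - p_j ∈ - N_K(q_{j+1})` for all `j`. -/
def IsBilliard {n : ℕ} (K T : Set (EuclideanSpace ℝ (Fin n))) (q : ClosedPolygon n) : Prop :=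
  (∀ j, q.vertex j ∈ frontier K) ∧
    ∃ p : ZMod q.m → EuclideanSpace ℝ (Fin n),
      (∀ j, p j ∈ frontier T) ∧
        ∀ j, q.vertex (j + 1) - q.vertex j ∈ normalCone T (p j) ∧
          -(p (j + 1) - p j) ∈ normalCone K (q.vertex (j + 1))

/-- `q` is an `ℓ_T`-minimizing closed `(K, T)`-Minkowski billiard trajectory: it has minimal
`ℓ_T`-length among all such trajectories, with any number of vertices. -/
def IsMinimizingBilliard {n : ℕ} (K T : Set (EuclideanSpace ℝ (Fin n)))
    (q : ClosedPolygon n) : Prop :=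
  q.IsBilliard K T ∧ ∀ q' : ClosedPolygon n, q'.IsBilliard K T → q.length T ≤ q'.length T

end ClosedPolygon

/-- Convergence of a sequence of subsets of `ℝⁿ` with respect to the Hausdorff distance (used
only for non-empty bounded sets, where this distance is finite). -/
def HausdorffTendsto {n : ℕ} (A : ℕ → Set (EuclideanSpace ℝ (Fin n)))
    (B : Set (EuclideanSpace ℝ (Fin n))) : Prop :=
  Tendsto (fun i => Metric.hausdorffDist (A i) B) atTop (𝓝 0)

/-! The proof rests on a variational description: the minimal length of a billiard trajectory is the
minimal `ℓ_T`-length of a closed polygon that cannot be translated into `interior K`.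

One inequality holds because the differences `p_j - p_{j+1}` are outer normals of `K` that sum to
zero, so a billiard trajectory cannot be translated into the interior
(`notTranslatable_of_isBilliardStep`). For the other, Helly's theorem bounds the number of vertices
by `n + 1` and compactness gives a shortest non-translatable polygon. Separation yields normals
`c_i` at its vertices with sum zero, and a second separation writes a multiple of `c` as differences
of points of `T` (`exists_dual_points`). These points make the polygon a billiard trajectory once
superfluous vertices are deleted (`exists_minimal_billiard`).

For the limit, the number of vertices is constant along a subsequence and the pairs `(q_j, p_j)`
stay bounded, so they subconverge. The billiard relations are closed conditions, the limit does not
collapse to a point, and its length is the limit of the lengths. It is minimal because `K_i ⊆ (1 +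
ε) K'` and `T_i ⊆ (1 + ε) T'` eventually, so a competitor for the limit bodies, scaled by `1 + ε`,
competes for the nearby ones. Limit vertices lying on the segment between their neighbours are
deleted without changing trace or length. -/

/-! ### Cyclic sequences and deletion of an entry. -/

theorem sum_cyclic_eq {X : Type*} {m : ℕ} (x : Fin (m + 1) → X) (G : X → X → ℝ) :
    ∑ i, G (x i) (x (i + 1)) =
      ∑ i : Fin m, G (x i.castSucc) (x i.succ) + G (x (Fin.last m)) (x 0) := by
  rw [Fin.sum_univ_castSucc]
  simp

theorem sum_cyclic_castSucc {X : Type*} {m : ℕ} (x : Fin (m + 2) → X) (G : X → X → ℝ) :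
    ∑ i, G (x i) (x (i + 1)) + G (x (Fin.last m).castSucc) (x 0) =
      ∑ i : Fin (m + 1), G (x i.castSucc) (x (i + 1).castSucc) +
        G (x (Fin.last m).castSucc) (x (Fin.last (m + 1))) + G (x (Fin.last (m + 1))) (x 0) := by
  rw [sum_cyclic_eq x G, sum_cyclic_eq (fun i : Fin (m + 1) => x i.castSucc) G,
    Fin.sum_univ_castSucc]
  simp
  ring

theorem forall_cyclic_castSucc {X : Type*} {m : ℕ} (x : Fin (m + 2) → X) (R : X → X → Prop) :
    (∀ i : Fin (m + 1), R (x i.castSucc) (x (i + 1).castSucc)) ↔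
      (∀ i : Fin m, R (x i.castSucc.castSucc) (x i.succ.castSucc)) ∧
        R (x (Fin.last m).castSucc) (x 0) := by
  constructor
  · intro h
    refine ⟨fun i => ?_, ?_⟩
    · simpa using h i.castSucc
    · simpa using h (Fin.last m)
  · rintro ⟨h, h'⟩ i
    induction i using Fin.lastCases with
    | last => simpa using h'
    | cast i => simpa using h i

/-- Deleting the entry `j` from a cyclic sequence. -/
theorem exists_cyclic_erase {X : Type*} {m : ℕ} (x : Fin (m + 2) → X) (j : Fin (m + 2)) :
    ∃ y : Fin (m + 1) → X,
      (∀ i, ∃ k, k ≠ j ∧ y i = x k) ∧ (∀ k, k ≠ j → ∃ i, y i = x k) ∧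
      (∀ G : X → X → ℝ, ∑ i, G (x i) (x (i + 1)) + G (x (j - 1)) (x (j + 1)) =
        ∑ i, G (y i) (y (i + 1)) + G (x (j - 1)) (x j) + G (x j) (x (j + 1))) ∧
      (∀ R : X → X → Prop, (∀ i, R (y i) (y (i + 1))) ↔
        (∀ i, i ≠ j → i + 1 ≠ j → R (x i) (x (i + 1))) ∧ R (x (j - 1)) (x (j + 1))) := by
  have hl : Fin.last (m + 1) + 1 = 0 := by simp
  have hl' : (Fin.last m).castSucc + 1 = Fin.last (m + 1) := by simp
  have e1 : Fin.last (m + 1) + (j + 1) = j := by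
    rw [add_comm j 1, ← add_assoc, hl, zero_add]
  have e2 : (Fin.last m).castSucc + (j + 1) = j - 1 := by
    rw [eq_sub_iff_add_eq, add_right_comm _ (j + 1) 1, hl', e1]
  -- Rotating by `j + 1` moves entry `j` to the last place, so deleting it is restriction along
  -- `castSucc`.
  set z : Fin (m + 2) → X := fun i => x (i + (j + 1)) with hz
  have z1 : z (Fin.last (m + 1)) = x j := by simp [hz, e1]
  have z2 : z (Fin.last m).castSucc = x (j - 1) := by simp only [hz, e2]
  have z3 : z 0 = x (j + 1) := by simp [hz]
  have z4 : ∀ i, z (i + 1) = x (i + (j + 1) + 1) := fun i => by simp only [hz, add_right_comm]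
  refine ⟨fun i => z i.castSucc, ?_, ?_, ?_, ?_⟩
  · refine fun i => ⟨i.castSucc + (j + 1), fun h => ?_, rfl⟩
    nth_rw 2 [← e1] at h
    rw [add_left_inj] at h
    exact (Fin.castSucc_lt_last i).ne h
  · intro k hk
    have : k - (j + 1) ≠ Fin.last (m + 1) := by
      intro h
      rw [sub_eq_iff_eq_add, e1] at h
      exact hk h
    obtain ⟨i, hi⟩ := Fin.exists_castSucc_eq.2 this
    exact ⟨i, by simp [hz, hi]⟩
  · intro G
    have := sum_cyclic_castSucc z G
    rw [z1, z2, z3] at this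
    rw [← this, ← Equiv.sum_comp (Equiv.addRight (j + 1)) (fun i => G (x i) (x (i + 1)))]
    simp only [z4]
    rfl
  · intro R
    rw [forall_cyclic_castSucc, z2, z3]
    refine and_congr_left fun _ => ⟨fun h i hi hi' => ?_, fun h i => ?_⟩
    · have h1 : i - (j + 1) ≠ Fin.last (m + 1) := by
        intro h
        rw [sub_eq_iff_eq_add, e1] at h
        exact hi h
      obtain ⟨k, hk⟩ := Fin.exists_castSucc_eq.2 h1
      have h2 : k ≠ Fin.last m := by
        rintro rfl
        rw [eq_sub_iff_add_eq, e2] at hk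
        exact hi' (by rw [← hk, sub_add_cancel])
      obtain ⟨l, rfl⟩ := Fin.exists_castSucc_eq.2 h2
      have := h l
      rw [← Fin.succ_castSucc, ← Fin.coeSucc_eq_succ, z4, hk] at this
      simpa [hz, hk] using this
    · have := h (i.castSucc.castSucc + (j + 1)) ?_ ?_
      · rw [← z4, Fin.coeSucc_eq_succ, Fin.succ_castSucc] at this
        exact this
      · intro h
        nth_rw 2 [← e1] at h
        rw [add_left_inj] at h
        exact (Fin.castSucc_lt_last _).ne h
      · intro h
        rw [add_right_comm] at h
        nth_rw 2 [← e1] at h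
        rw [add_left_inj, Fin.coeSucc_eq_succ, Fin.succ_castSucc] at h
        exact (Fin.castSucc_lt_last _).ne h

/-! ### Support functions and normal cones. -/

section SupportFunction

variable {n : ℕ} {K T : Set (EuclideanSpace ℝ (Fin n))}

theorem IsBody.zero_mem (hT : IsBody T) : (0 : EuclideanSpace ℝ (Fin n)) ∈ T :=
  interior_subset hT.zero_mem_interior

theorem IsBody.exists_closedBall_subset (hT : IsBody T) :
    ∃ r > 0, Metric.closedBall (0 : EuclideanSpace ℝ (Fin n)) r ⊆ T :=
  Metric.nhds_basis_closedBall.mem_iff.1 (mem_interior_iff_mem_nhds.1 hT.zero_mem_interior)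

-- The Minkowski functional of the polar is the support function of `T`, and `v ∈ normalCone T y`
-- says that `y` maximises `inner ℝ v` on `T`.
open scoped Pointwise in
theorem gauge_polarBody_eq_inner (h0 : (0 : EuclideanSpace ℝ (Fin n)) ∈ T)
    {v y : EuclideanSpace ℝ (Fin n)} (hy : y ∈ T) (hv : v ∈ normalCone T y) :
    gauge (polarBody T) v = inner ℝ v y := by
  have hv' : ∀ z ∈ T, inner ℝ v z ≤ inner ℝ v y := fun z hz => by
    have := hv z hz
    rw [inner_sub_right] at this
    linarith
  have hset : {r : ℝ | 0 < r ∧ v ∈ r • polarBody T} = {r : ℝ | 0 < r ∧ inner ℝ v y ≤ r} := by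
    ext r
    simp only [Set.mem_ofPred_eq]
    refine and_congr_right fun hr => ?_
    rw [Set.mem_smul_set_iff_inv_smul_mem₀ hr.ne']
    have key : ∀ z, inner ℝ (r⁻¹ • v) z ≤ 1 ↔ inner ℝ v z ≤ r := fun z => by
      rw [real_inner_smul_left, inv_mul_le_iff₀ hr, mul_one]
    simp only [polarBody, Set.mem_ofPred_eq, key]
    exact ⟨fun h => h y hy, fun h z hz => (hv' z hz).trans h⟩
  have h0' : 0 ≤ inner ℝ v y := by simpa using hv' 0 h0
  rw [gauge, hset]
  refine le_antisymm (le_of_forall_pos_le_add fun ε hε => ?_) ?_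
  · exact csInf_le ⟨0, fun r hr => hr.1.le⟩ ⟨by positivity, by linarith⟩
  · exact le_csInf ⟨inner ℝ v y + 1, by positivity, by linarith⟩ fun r hr => hr.2

theorem IsBody.exists_mem_normalCone (hT : IsBody T) (v : EuclideanSpace ℝ (Fin n)) :
    ∃ y ∈ T, v ∈ normalCone T y := by
  obtain ⟨y, hy, hmax⟩ := hT.isCompact.exists_isMaxOn ⟨0, hT.zero_mem⟩
    (f := fun y => inner ℝ v y) (by fun_prop)
  refine ⟨y, hy, fun z hz => ?_⟩
  have : inner ℝ v z ≤ inner ℝ v y := hmax hz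
  rw [inner_sub_right]
  linarith

theorem IsBody.inner_le_gauge (hT : IsBody T) (v : EuclideanSpace ℝ (Fin n))
    {y : EuclideanSpace ℝ (Fin n)} (hy : y ∈ T) : inner ℝ v y ≤ gauge (polarBody T) v := by
  obtain ⟨z, hz, hv⟩ := hT.exists_mem_normalCone v
  rw [gauge_polarBody_eq_inner hT.zero_mem hz hv]
  have := hv y hy
  rw [inner_sub_right] at this
  linarith

theorem IsBody.gauge_add_le (hT : IsBody T) (v w : EuclideanSpace ℝ (Fin n)) :
    gauge (polarBody T) (v + w) ≤ gauge (polarBody T) v + gauge (polarBody T) w := by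
  obtain ⟨z, hz, hv⟩ := hT.exists_mem_normalCone (v + w)
  rw [gauge_polarBody_eq_inner hT.zero_mem hz hv, inner_add_left]
  exact add_le_add (hT.inner_le_gauge v hz) (hT.inner_le_gauge w hz)

theorem mul_norm_le_gauge_polarBody (hT : IsBody T) {r : ℝ} (hr : 0 ≤ r)
    (hrT : Metric.closedBall (0 : EuclideanSpace ℝ (Fin n)) r ⊆ T)
    (v : EuclideanSpace ℝ (Fin n)) : r * ‖v‖ ≤ gauge (polarBody T) v := by
  rcases eq_or_ne v 0 with rfl | hv
  · simp
  have hv' : 0 < ‖v‖ := norm_pos_iff.2 hv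
  have hmem : (r / ‖v‖) • v ∈ T := hrT <| by
    rw [mem_closedBall_zero_iff, norm_smul, Real.norm_eq_abs, abs_of_nonneg (by positivity),
      div_mul_cancel₀ _ hv'.ne']
  refine le_trans (le_of_eq ?_) (hT.inner_le_gauge v hmem)
  rw [real_inner_smul_right, real_inner_self_eq_norm_sq]
  field_simp

theorem IsBody.gauge_pos (hT : IsBody T) {v : EuclideanSpace ℝ (Fin n)} (hv : v ≠ 0) :
    0 < gauge (polarBody T) v := by
  obtain ⟨r, hr, hrT⟩ := hT.exists_closedBall_subset
  have := norm_pos_iff.2 hv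
  exact lt_of_lt_of_le (by positivity) (mul_norm_le_gauge_polarBody hT hr.le hrT v)

theorem convex_polarBody : Convex ℝ (polarBody T) := by
  intro x hx z hz a b ha hb hab y hy
  rw [inner_add_left, real_inner_smul_left, real_inner_smul_left]
  nlinarith [mul_le_mul_of_nonneg_left (hx y hy) ha, mul_le_mul_of_nonneg_left (hz y hy) hb]

theorem IsBody.polarBody_mem_nhds (hT : IsBody T) : polarBody T ∈ 𝓝 0 := by
  obtain ⟨R, hR⟩ := hT.isCompact.isBounded.exists_norm_le
  have hR0 : 0 ≤ R := (norm_nonneg _).trans (hR 0 hT.zero_mem)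
  refine mem_of_superset (Metric.ball_mem_nhds 0 (show 0 < 1 / (R + 1) by positivity)) ?_
  intro x hx y hy
  rw [mem_ball_zero_iff] at hx
  calc inner ℝ x y ≤ ‖x‖ * ‖y‖ := real_inner_le_norm x y
    _ ≤ 1 / (R + 1) * (R + 1) :=
      mul_le_mul hx.le ((hR y hy).trans (by linarith)) (norm_nonneg _) (by positivity)
    _ = 1 := by field_simp

theorem IsBody.continuous_gauge_polarBody (hT : IsBody T) : Continuous (gauge (polarBody T)) :=
  continuous_gauge convex_polarBody hT.polarBody_mem_nhds

/-- An interior point can be pushed a little in the direction `v` without leaving `K`, which makes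
the normal inequality strict. -/
theorem inner_neg_of_mem_interior {v y z : EuclideanSpace ℝ (Fin n)} (hv : v ∈ normalCone K z)
    (hy : y ∈ interior K) (hv0 : v ≠ 0) : inner ℝ v (y - z) < 0 := by
  obtain ⟨ε, hε, hεK⟩ := Metric.nhds_basis_closedBall.mem_iff.1 (mem_interior_iff_mem_nhds.1 hy)
  have hv' : 0 < ‖v‖ := norm_pos_iff.2 hv0
  have hmem : y + (ε / ‖v‖) • v ∈ K := hεK <| by
    rw [mem_closedBall_iff_norm, add_sub_cancel_left, norm_smul, Real.norm_eq_abs,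
      abs_of_nonneg (by positivity), div_mul_cancel₀ _ hv'.ne']
  have h := hv _ hmem
  rw [add_sub_right_comm, inner_add_right, real_inner_smul_right, real_inner_self_eq_norm_sq] at h
  have : 0 < ε / ‖v‖ * ‖v‖ ^ 2 := by positivity
  linarith

/-- This is why `IsBilliardStep` can omit the boundary conditions: a nonzero normal restores them.
-/
theorem mem_frontier_of_mem_normalCone {v z : EuclideanSpace ℝ (Fin n)} (hz : z ∈ K)
    (hv : v ∈ normalCone K z) (hv0 : v ≠ 0) : z ∈ frontier K :=
  ⟨subset_closure hz, fun h => by simpa using inner_neg_of_mem_interior hv h hv0⟩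

theorem IsBody.mem_of_mem_frontier (hK : IsBody K) {z : EuclideanSpace ℝ (Fin n)}
    (hz : z ∈ frontier K) : z ∈ K :=
  hK.isCompact.isClosed.frontier_subset hz

theorem add_mem_normalCone {v w z : EuclideanSpace ℝ (Fin n)} (hv : v ∈ normalCone K z)
    (hw : w ∈ normalCone K z) : v + w ∈ normalCone K z := fun y hy => by
  rw [inner_add_left]
  linarith [hv y hy, hw y hy]

theorem smul_mem_normalCone {v z : EuclideanSpace ℝ (Fin n)} {c : ℝ} (hc : 0 ≤ c)
    (hv : v ∈ normalCone K z) : c • v ∈ normalCone K z := fun y hy => by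
  rw [real_inner_smul_left]
  exact mul_nonpos_of_nonneg_of_nonpos hc (hv y hy)

/-- A normal at a point in the relative interior of a chord is normal at the ends of the chord. -/
theorem mem_normalCone_right_of_mem_segment {a b z v : EuclideanSpace ℝ (Fin n)} (ha : a ∈ K)
    (hz : z ∈ segment ℝ a b) (hza : z ≠ b → z ≠ a) (hb : b ∈ K)
    (hv : v ∈ normalCone K z) : v ∈ normalCone K b := by
  by_cases hzb : z = b
  · rwa [← hzb]
  obtain ⟨s, t, hs, ht, hst, rfl⟩ := hz
  have ht0 : t ≠ 0 := by
    rintro rfl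
    exact hza hzb (by simp_all)
  have hs0 : s ≠ 0 := by
    rintro rfl
    exact hzb (by simp_all)
  have h1 := hv a ha
  have h2 := hv b hb
  have e1 : a - (s • a + t • b) = t • (a - b) := by
    rw [← eq_sub_iff_add_eq] at hst; subst hst; module
  have e2 : b - (s • a + t • b) = -(s • (a - b)) := by
    rw [← eq_sub_iff_add_eq] at hst; subst hst; module
  rw [e1, real_inner_smul_right] at h1
  rw [e2, inner_neg_right, real_inner_smul_right] at h2
  -- The ends lie on opposite sides of `z`, so the two normal inequalities force `v` to be
  -- orthogonal to the chord.
  have h3 : inner ℝ v (a - b) = 0 := by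
    have h1' : inner ℝ v (a - b) ≤ 0 := by
      by_contra h
      push Not at h
      have : 0 < t * inner ℝ v (a - b) := by positivity
      linarith
    have h2' : 0 ≤ inner ℝ v (a - b) := by
      by_contra h
      push Not at h
      have : s * inner ℝ v (a - b) < 0 := mul_neg_of_pos_of_neg (by positivity) h
      linarith
    linarith
  intro y hy
  have h := hv y hy
  have e3 : y - (s • a + t • b) = y - b - s • (a - b) := by
    rw [← eq_sub_iff_add_eq'] at hst; subst hst; module
  rw [e3, inner_sub_right, real_inner_smul_right, h3] at h
  linarith

end SupportFunction

/-! ### Deleting superfluous vertices. -/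

section Reduction

variable {n : ℕ} {K T : Set (EuclideanSpace ℝ (Fin n))}

/-- The relation between consecutive pairs `(q_j, p_j)`, `(q_{j+1}, p_{j+1})` of a closed
`(K, T)`-Minkowski billiard trajectory, without the requirement that the points lie on the
boundaries. -/
structure IsBilliardStep (K T : Set (EuclideanSpace ℝ (Fin n)))
    (a b : EuclideanSpace ℝ (Fin n) × EuclideanSpace ℝ (Fin n)) : Prop where
  fst_mem : a.1 ∈ K
  snd_mem : a.2 ∈ T
  edge : b.1 - a.1 ∈ normalCone T a.2
  dual_edge : a.2 - b.2 ∈ normalCone K b.1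

/-- The `ℓ_T`-length of a cyclic sequence of points. -/
noncomputable def cyclicLength (T : Set (EuclideanSpace ℝ (Fin n))) {m : ℕ}
    (q : Fin (m + 1) → EuclideanSpace ℝ (Fin n)) : ℝ :=
  ∑ i, gauge (polarBody T) (q (i + 1) - q i)

/-- The union of the edges of a cyclic sequence of points. -/
def cyclicTrace {m : ℕ} (q : Fin (m + 1) → EuclideanSpace ℝ (Fin n)) :
    Set (EuclideanSpace ℝ (Fin n)) :=
  ⋃ i, segment ℝ (q i) (q (i + 1))

theorem segment_eq_union_of_mem {a b c : EuclideanSpace ℝ (Fin n)} (hb : b ∈ segment ℝ a c) :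
    segment ℝ a c = segment ℝ a b ∪ segment ℝ b c := by
  refine Set.Subset.antisymm ?_ (Set.union_subset
    ((convex_segment a c).segment_subset (left_mem_segment ℝ a c) hb)
    ((convex_segment a c).segment_subset hb (right_mem_segment ℝ a c)))
  rw [segment_eq_image_lineMap] at hb
  obtain ⟨t, ⟨ht0, ht1⟩, rfl⟩ := hb
  intro x hx
  rw [segment_eq_image_lineMap] at hx
  obtain ⟨s, ⟨hs0, hs1⟩, rfl⟩ := hx
  rcases le_total s t with hst | hst
  · left
    rcases eq_or_lt_of_le ht0 with h | h
    · have : s = t := by linarith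
      rw [this]; exact right_mem_segment _ _ _
    rw [segment_eq_image_lineMap]
    refine ⟨s / t, ⟨by positivity, by rw [div_le_one h]; exact hst⟩, ?_⟩
    simp only [AffineMap.lineMap_apply_module', add_sub_cancel_right, smul_smul]
    rw [div_mul_cancel₀ _ h.ne']
  · right
    rcases eq_or_lt_of_le ht1 with h | h
    · have : s = t := by linarith
      rw [this]; exact left_mem_segment _ _ _
    have h' : 0 < 1 - t := by linarith
    rw [segment_eq_image_lineMap]
    refine ⟨(s - t) / (1 - t), ⟨div_nonneg (by linarith) h'.le,
      by rw [div_le_one h']; linarith⟩, ?_⟩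
    have : s = (s - t) / (1 - t) * (1 - t) + t := by rw [div_mul_cancel₀ _ h'.ne']; ring
    simp only [AffineMap.lineMap_apply_module']
    conv_rhs => rw [this]
    module

theorem gauge_add_gauge_of_mem_segment (s : Set (EuclideanSpace ℝ (Fin n)))
    {a b c : EuclideanSpace ℝ (Fin n)} (hb : b ∈ segment ℝ a c) :
    gauge s (b - a) + gauge s (c - b) = gauge s (c - a) := by
  obtain ⟨u, t, hu, ht, hut, rfl⟩ := hb
  have e1 : u • a + t • c - a = t • (c - a) := by
    rw [← eq_sub_iff_add_eq] at hut; subst hut; module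
  have e2 : c - (u • a + t • c) = u • (c - a) := by
    rw [← eq_sub_iff_add_eq] at hut; subst hut; module
  rw [e1, e2, gauge_smul_of_nonneg ht, gauge_smul_of_nonneg hu, smul_eq_mul, smul_eq_mul,
    ← add_mul, add_comm t, hut, one_mul]

variable {a b c : EuclideanSpace ℝ (Fin n) × EuclideanSpace ℝ (Fin n)}

theorem IsBilliardStep.gauge_eq (hT : IsBody T) (h : IsBilliardStep K T a b) :
    gauge (polarBody T) (b.1 - a.1) = inner ℝ (b.1 - a.1) a.2 :=
  gauge_polarBody_eq_inner hT.zero_mem h.snd_mem h.edge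

/-- With a common dual point both edges lie in one normal cone of `T`, and a cone contains their
sum. -/
theorem IsBilliardStep.trans_of_snd_eq (hab : IsBilliardStep K T a b)
    (hbc : IsBilliardStep K T b c) (h : a.2 = b.2) : IsBilliardStep K T a c where
  fst_mem := hab.fst_mem
  snd_mem := hab.snd_mem
  edge := by
    rw [← sub_add_sub_cancel c.1 b.1 a.1]
    exact add_mem_normalCone (h ▸ hbc.edge) hab.edge
  dual_edge := h ▸ hbc.dual_edge

theorem IsBilliardStep.trans_of_fst_eq (hab : IsBilliardStep K T a b)
    (hbc : IsBilliardStep K T b c) (h : b.1 = c.1) : IsBilliardStep K T a c where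
  fst_mem := hab.fst_mem
  snd_mem := hab.snd_mem
  edge := h ▸ hab.edge
  dual_edge := by
    rw [← sub_add_sub_cancel a.2 b.2 c.2]
    exact add_mem_normalCone (h ▸ hab.dual_edge) hbc.dual_edge

/-- The new edge is a positive multiple of the old one. The normal `a.2 - b.2` at `b.1` is
transported along the chord to `c.1`, where it adds to `b.2 - c.2`. -/
theorem IsBilliardStep.trans_of_mem_segment (hab : IsBilliardStep K T a b)
    (hbc : IsBilliardStep K T b c) (hc : c.1 ∈ K) (hne : b.1 ≠ a.1)
    (h : b.1 ∈ segment ℝ a.1 c.1) : IsBilliardStep K T a c where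
  fst_mem := hab.fst_mem
  snd_mem := hab.snd_mem
  edge := by
    obtain ⟨u, t, hu, ht, hut, hb⟩ := h
    have e1 : b.1 - a.1 = t • (c.1 - a.1) := by
      rw [← hb]; rw [← eq_sub_iff_add_eq] at hut; subst hut; module
    have ht0 : t ≠ 0 := by
      rintro rfl
      rw [zero_smul, sub_eq_zero] at e1
      exact hne e1
    have e2 : c.1 - a.1 = t⁻¹ • (b.1 - a.1) := by rw [e1, inv_smul_smul₀ ht0]
    rw [e2]
    exact smul_mem_normalCone (inv_nonneg.2 ht) hab.edge
  dual_edge := by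
    rw [← sub_add_sub_cancel a.2 b.2 c.2]
    exact add_mem_normalCone (mem_normalCone_right_of_mem_segment hab.fst_mem h (fun _ => hne) hc
      hab.dual_edge) hbc.dual_edge

theorem cyclicTrace_eq_of_erase {m : ℕ} {q : Fin (m + 2) → EuclideanSpace ℝ (Fin n)}
    {q' : Fin (m + 1) → EuclideanSpace ℝ (Fin n)} {j : Fin (m + 2)}
    (h : ∀ R : EuclideanSpace ℝ (Fin n) → EuclideanSpace ℝ (Fin n) → Prop,
      (∀ i, R (q' i) (q' (i + 1))) ↔
        (∀ i, i ≠ j → i + 1 ≠ j → R (q i) (q (i + 1))) ∧ R (q (j - 1)) (q (j + 1)))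
    (hj : q j ∈ segment ℝ (q (j - 1)) (q (j + 1))) : cyclicTrace q' = cyclicTrace q := by
  have hseg := segment_eq_union_of_mem hj
  refine Set.Subset.antisymm ?_ ?_
  · rw [cyclicTrace, Set.iUnion_subset_iff]
    -- Inclusion of traces is a statement about consecutive pairs, so it is an instance of the
    -- relation `R`.
    refine (h fun a b => segment ℝ a b ⊆ cyclicTrace q).2 ⟨fun i _ _ => ?_, ?_⟩
    · exact Set.subset_iUnion (fun i => segment ℝ (q i) (q (i + 1))) i
    · rw [hseg]
      refine Set.union_subset ?_ (Set.subset_iUnion (fun i => segment ℝ (q i) (q (i + 1))) j)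
      have := Set.subset_iUnion (fun i => segment ℝ (q i) (q (i + 1))) (j - 1)
      simpa only [sub_add_cancel, cyclicTrace] using this
  · obtain ⟨h1, h2⟩ := (h fun a b => segment ℝ a b ⊆ cyclicTrace q').1
      (fun i => Set.subset_iUnion (fun i => segment ℝ (q' i) (q' (i + 1))) i)
    rw [hseg, Set.union_subset_iff] at h2
    refine Set.iUnion_subset fun i => ?_
    by_cases hi : i = j
    · rw [hi]; exact h2.2
    by_cases hi' : i + 1 = j
    · rw [← eq_sub_iff_add_eq] at hi'
      rw [hi', sub_add_cancel]; exact h2.1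
    exact h1 i hi hi'

/-- Vertices that lie on the segment joining their neighbours can be deleted from a billiard
trajectory. -/
theorem exists_nondegenerate_billiard {m : ℕ}
    (x : Fin (m + 1) → EuclideanSpace ℝ (Fin n) × EuclideanSpace ℝ (Fin n))
    (hx : ∀ i, IsBilliardStep K T (x i) (x (i + 1)))
    (hpos : 0 < cyclicLength T fun i => (x i).1) :
    ∃ k < m, ∃ y : Fin (k + 2) → EuclideanSpace ℝ (Fin n) × EuclideanSpace ℝ (Fin n),
      (∀ i, IsBilliardStep K T (y i) (y (i + 1))) ∧
      (cyclicLength T fun i => (y i).1) = (cyclicLength T fun i => (x i).1) ∧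
      (cyclicTrace fun i => (y i).1) = (cyclicTrace fun i => (x i).1) ∧
      (∀ i, ∃ l, y i = x l) ∧
      ∀ i, (y i).1 ∉ segment ℝ (y (i - 1)).1 (y (i + 1)).1 := by
  induction m with
  | zero =>
    simp [cyclicLength] at hpos
  | succ m ih =>
    by_cases hdeg : ∀ i, (x i).1 ∉ segment ℝ (x (i - 1)).1 (x (i + 1)).1
    · exact ⟨m, m.lt_succ_self, x, hx, rfl, rfl, fun i => ⟨i, rfl⟩, hdeg⟩
    push Not at hdeg
    -- If a degenerate vertex equals its predecessor, the predecessor is deleted instead, since it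
    -- coincides with its own successor.
    obtain ⟨j, hj, hj'⟩ : ∃ j, (x j).1 ∈ segment ℝ (x (j - 1)).1 (x (j + 1)).1 ∧
        ((x j).1 = (x (j + 1)).1 ∨ (x j).1 ≠ (x (j - 1)).1) := by
      obtain ⟨j, hj⟩ := hdeg
      by_cases h : (x j).1 = (x (j - 1)).1
      · refine ⟨j - 1, ?_, Or.inl ?_⟩
        · rw [sub_add_cancel, h]; exact right_mem_segment _ _ _
        · rw [sub_add_cancel, h]
      · exact ⟨j, hj, Or.inr h⟩
    obtain ⟨y, hmem, -, hsum, hrel⟩ := exists_cyclic_erase x j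
    have hab := hx (j - 1)
    rw [sub_add_cancel] at hab
    have hstep : IsBilliardStep K T (x (j - 1)) (x (j + 1)) := by
      rcases hj' with h | h
      · exact hab.trans_of_fst_eq (hx j) h
      · exact hab.trans_of_mem_segment (hx j) (hx (j + 1)).fst_mem h hj
    have hy : ∀ i, IsBilliardStep K T (y i) (y (i + 1)) :=
      (hrel _).2 ⟨fun i _ _ => hx i, hstep⟩
    have hlen : (cyclicLength T fun i => (y i).1) = (cyclicLength T fun i => (x i).1) := by
      have h1 := hsum fun a b => gauge (polarBody T) (b.1 - a.1)
      have h2 := gauge_add_gauge_of_mem_segment (polarBody T) hj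
      simp only [cyclicLength]
      linarith
    have htr : (cyclicTrace fun i => (y i).1) = (cyclicTrace fun i => (x i).1) :=
      cyclicTrace_eq_of_erase (fun R => hrel fun a b => R a.1 b.1) hj
    obtain ⟨k, hk, z, hz, hzl, hzt, hzm, hzn⟩ := ih y hy (hlen ▸ hpos)
    refine ⟨k, hk.trans m.lt_succ_self, z, hz, hzl.trans hlen, hzt.trans htr, fun i => ?_, hzn⟩
    obtain ⟨l, hl⟩ := hzm i
    obtain ⟨l', -, hl'⟩ := hmem l
    exact ⟨l', hl.trans hl'⟩

/-- Vertices without reflection can be deleted from a billiard trajectory. -/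
theorem exists_reflecting_billiard (hT : IsBody T) {m : ℕ}
    (x : Fin (m + 1) → EuclideanSpace ℝ (Fin n) × EuclideanSpace ℝ (Fin n))
    (hx : ∀ i, IsBilliardStep K T (x i) (x (i + 1)))
    (hpos : 0 < cyclicLength T fun i => (x i).1) :
    ∃ k < m, ∃ y : Fin (k + 2) → EuclideanSpace ℝ (Fin n) × EuclideanSpace ℝ (Fin n),
      (∀ i, IsBilliardStep K T (y i) (y (i + 1))) ∧
      (cyclicLength T fun i => (y i).1) = (cyclicLength T fun i => (x i).1) ∧
      ∀ i, (y (i - 1)).2 ≠ (y i).2 := by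
  induction m with
  | zero =>
    simp [cyclicLength] at hpos
  | succ m ih =>
    by_cases hdeg : ∀ i, (x (i - 1)).2 ≠ (x i).2
    · exact ⟨m, m.lt_succ_self, x, hx, rfl, hdeg⟩
    push Not at hdeg
    obtain ⟨j, hj⟩ := hdeg
    obtain ⟨y, hmem, -, hsum, hrel⟩ := exists_cyclic_erase x j
    have hab := hx (j - 1)
    rw [sub_add_cancel] at hab
    have hstep : IsBilliardStep K T (x (j - 1)) (x (j + 1)) := hab.trans_of_snd_eq (hx j) hj
    have hy : ∀ i, IsBilliardStep K T (y i) (y (i + 1)) :=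
      (hrel _).2 ⟨fun i _ _ => hx i, hstep⟩
    have hlen : (cyclicLength T fun i => (y i).1) = (cyclicLength T fun i => (x i).1) := by
      have h1 := hsum fun a b => gauge (polarBody T) (b.1 - a.1)
      -- Lengths of both old edges and of the new edge are inner products with the same dual point,
      -- hence additive.
      have h2 := hab.gauge_eq hT
      have h3 := (hx j).gauge_eq hT
      have h4 := hstep.gauge_eq hT
      rw [← sub_add_sub_cancel _ (x j).1, inner_add_left, sub_add_sub_cancel] at h4
      rw [← hj] at h3
      simp only [cyclicLength]
      linarith
    obtain ⟨k, hk, z, hz, hzl, hzn⟩ := ih y hy (hlen ▸ hpos)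
    exact ⟨k, hk.trans m.lt_succ_self, z, hz, hzl.trans hlen, hzn⟩

end Reduction

/-! ### Polygons that cannot be translated into the interior. -/

section Nontranslatable

variable {n : ℕ} {K T : Set (EuclideanSpace ℝ (Fin n))}

/-- The family of points `q` cannot be translated into the interior of `K`. -/
def NotTranslatable {ι : Type*} (K : Set (EuclideanSpace ℝ (Fin n)))
    (q : ι → EuclideanSpace ℝ (Fin n)) : Prop :=
  ∀ t, ∃ j, q j + t ∉ interior K

theorem NotTranslatable.mono {ι κ : Type*} {q : ι → EuclideanSpace ℝ (Fin n)}
    {q' : κ → EuclideanSpace ℝ (Fin n)} (h : NotTranslatable K q)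
    (hq : ∀ j, ∃ i, q' i = q j) : NotTranslatable K q' := fun t => by
  obtain ⟨j, hj⟩ := h t
  obtain ⟨i, hi⟩ := hq j
  exact ⟨i, hi ▸ hj⟩

theorem isClosed_notTranslatable {ι : Type*} [Finite ι] :
    IsClosed {q : ι → EuclideanSpace ℝ (Fin n) | NotTranslatable K q} := by
  have h : {q : ι → EuclideanSpace ℝ (Fin n) | NotTranslatable K q} =
      ⋂ t, ⋃ j, (fun q => q j + t) ⁻¹' (interior K)ᶜ := by
    ext q; simp [NotTranslatable]
  rw [h]
  refine isClosed_iInter fun t => isClosed_iUnion_of_finite fun j => ?_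
  exact isOpen_interior.isClosed_compl.preimage (by fun_prop)

theorem cyclicLength_nonneg {m : ℕ} (q : Fin (m + 1) → EuclideanSpace ℝ (Fin n)) :
    0 ≤ cyclicLength T q :=
  Finset.sum_nonneg fun _ _ => gauge_nonneg _

theorem eq_of_forall_eq_add_one {X : Type*} {m : ℕ} {q : Fin (m + 1) → X}
    (h : ∀ i, q (i + 1) = q i) (i : Fin (m + 1)) : q i = q 0 := by
  induction i using Fin.induction with
  | zero => rfl
  | succ i ih => rw [← Fin.coeSucc_eq_succ, h, ih]

theorem cyclicLength_pos (hT : IsBody T) {m : ℕ} {q : Fin (m + 1) → EuclideanSpace ℝ (Fin n)}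
    {i : Fin (m + 1)} (hi : q i ≠ q 0) : 0 < cyclicLength T q := by
  refine (cyclicLength_nonneg q).lt_of_ne fun h => hi ?_
  rw [cyclicLength, eq_comm, Finset.sum_eq_zero_iff_of_nonneg fun _ _ => gauge_nonneg _] at h
  refine eq_of_forall_eq_add_one (fun j => ?_) i
  by_contra hj
  exact (hT.gauge_pos (sub_ne_zero.2 hj)).ne' (h j (Finset.mem_univ j))

theorem NotTranslatable.cyclicLength_pos (hK : IsBody K) (hT : IsBody T) {m : ℕ}
    {q : Fin (m + 1) → EuclideanSpace ℝ (Fin n)} (hq : NotTranslatable K q) :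
    0 < cyclicLength T q := by
  obtain ⟨i, hi⟩ := hq (-q 0)
  refine _root_.cyclicLength_pos hT (i := i) fun h => hi ?_
  rw [h, add_neg_cancel]
  exact hK.zero_mem_interior

/-- Cyclic summation by parts. -/
theorem sum_inner_sub_eq {m : ℕ} (q p : Fin (m + 1) → EuclideanSpace ℝ (Fin n)) :
    ∑ i, inner ℝ (q (i + 1) - q i) (p i) = ∑ i, inner ℝ (q (i + 1)) (p i - p (i + 1)) := by
  have h := Equiv.sum_comp (Equiv.addRight (1 : Fin (m + 1))) fun i => inner ℝ (q i) (p i)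
  simp only [Equiv.coe_addRight] at h
  simp only [inner_sub_left, inner_sub_right, Finset.sum_sub_distrib, h]

theorem sum_sub_add_one {X : Type*} [AddCommGroup X] {m : ℕ} (p : Fin (m + 1) → X) :
    ∑ i, (p i - p (i + 1)) = 0 := by
  have h := Equiv.sum_comp (Equiv.addRight (1 : Fin (m + 1))) p
  simp only [Equiv.coe_addRight] at h
  rw [Finset.sum_sub_distrib, h, sub_self]

/-- A billiard trajectory of positive length cannot be translated into the interior of the
table. -/
theorem notTranslatable_of_isBilliardStep (hT : IsBody T) {m : ℕ}
    {x : Fin (m + 1) → EuclideanSpace ℝ (Fin n) × EuclideanSpace ℝ (Fin n)}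
    (hx : ∀ i, IsBilliardStep K T (x i) (x (i + 1)))
    (hpos : 0 < cyclicLength T fun i => (x i).1) : NotTranslatable K fun i => (x i).1 := by
  intro t
  by_contra! h
  have hle : ∀ i, inner ℝ ((x i).2 - (x (i + 1)).2) t ≤ 0 := fun i => by
    simpa using (hx i).dual_edge _ (interior_subset (h (i + 1)))
  have hsum : ∑ i, inner ℝ ((x i).2 - (x (i + 1)).2) t = 0 := by
    rw [← sum_inner, sum_sub_add_one fun i => (x i).2, inner_zero_left]
  -- Nonpositive terms with sum zero all vanish, while a nonzero normal would give a strictly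
  -- negative term. So all dual points agree and the length is zero.
  have hz := (Finset.sum_eq_zero_iff_of_nonpos fun i _ => hle i).1 hsum
  have hz' : ∀ i, (x i).2 - (x (i + 1)).2 = 0 := fun i => by
    by_contra hne
    have := inner_neg_of_mem_interior (hx i).dual_edge (h (i + 1)) hne
    rw [add_sub_cancel_left, hz i (Finset.mem_univ i)] at this
    exact this.false
  have hlen : (cyclicLength T fun i => (x i).1) =
      ∑ i, inner ℝ ((x (i + 1)).1 - (x i).1) (x i).2 :=
    Finset.sum_congr rfl fun i _ => (hx i).gauge_eq hT
  rw [hlen, sum_inner_sub_eq (fun i => (x i).1) (fun i => (x i).2)] at hpos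
  simp [hz'] at hpos

theorem cyclicLength_erase_le (hT : IsBody T) {m : ℕ}
    {q : Fin (m + 2) → EuclideanSpace ℝ (Fin n)} {q' : Fin (m + 1) → EuclideanSpace ℝ (Fin n)}
    {j : Fin (m + 2)}
    (h : ∀ G : EuclideanSpace ℝ (Fin n) → EuclideanSpace ℝ (Fin n) → ℝ,
      ∑ i, G (q i) (q (i + 1)) + G (q (j - 1)) (q (j + 1)) =
        ∑ i, G (q' i) (q' (i + 1)) + G (q (j - 1)) (q j) + G (q j) (q (j + 1))) :
    cyclicLength T q' ≤ cyclicLength T q := by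
  have h1 := h fun a b => gauge (polarBody T) (b - a)
  have h2 := hT.gauge_add_le (q (j + 1) - q j) (q j - q (j - 1))
  rw [sub_add_sub_cancel] at h2
  simp only [cyclicLength]
  linarith

/-- By Helly's theorem, `n + 1` of the points cannot be translated into the interior of `K`. -/
theorem NotTranslatable.exists_finset (hK : Convex ℝ K) {ι : Type*} [Fintype ι]
    {q : ι → EuclideanSpace ℝ (Fin n)} (hq : NotTranslatable K q) :
    ∃ I : Finset ι, I.card ≤ n + 1 ∧ NotTranslatable K fun i : I => q i := by
  by_contra! h
  -- For each vertex the admissible translations form a convex set; non-translatability means that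
  -- these sets have no common point.
  have hH := Convex.helly_theorem' (𝕜 := ℝ) (F := fun i => (fun t => q i + t) ⁻¹' interior K)
    (s := Finset.univ) (fun i _ => hK.interior.translate_preimage_right _) (fun I _ hI => by
      have := h I (by simpa using hI)
      simp only [NotTranslatable, not_forall, not_exists, not_not] at this
      obtain ⟨t, ht⟩ := this
      exact ⟨t, Set.mem_iInter₂.2 fun i hi => ht ⟨i, hi⟩⟩)
  obtain ⟨t, ht⟩ := hH
  obtain ⟨i, hi⟩ := hq t
  exact hi (Set.mem_iInter₂.1 ht i (Finset.mem_univ i))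

theorem NotTranslatable.exists_of_lt (hK : Convex ℝ K) (hT : IsBody T) {m : ℕ} (hm : n ≤ m)
    {q : Fin (m + 1) → EuclideanSpace ℝ (Fin n)} (hq : NotTranslatable K q) :
    ∃ q' : Fin (n + 1) → EuclideanSpace ℝ (Fin n),
      NotTranslatable K q' ∧ cyclicLength T q' ≤ cyclicLength T q := by
  induction m, hm using Nat.le_induction with
  | base => exact ⟨q, hq, le_rfl⟩
  | succ m hm ih =>
    obtain ⟨I, hI, hqI⟩ := hq.exists_finset hK
    obtain ⟨j, hj⟩ : ∃ j, j ∉ I := by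
      by_contra! h
      have : I = Finset.univ := Finset.eq_univ_iff_forall.2 h
      rw [this, Finset.card_univ, Fintype.card_fin] at hI
      omega
    obtain ⟨q', -, hmem, hsum, -⟩ := exists_cyclic_erase q j
    obtain ⟨q'', h1, h2⟩ := ih (hqI.mono fun i => hmem i fun h => hj (h ▸ i.2))
    exact ⟨q'', h1, h2.trans (cyclicLength_erase_le hT hsum)⟩

/-- Repeating the last vertex adds an edge of length zero. -/
theorem NotTranslatable.exists_of_le {m : ℕ} (hm : m ≤ n)
    {q : Fin (m + 1) → EuclideanSpace ℝ (Fin n)} (hq : NotTranslatable K q) :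
    ∃ q' : Fin (n + 1) → EuclideanSpace ℝ (Fin n),
      NotTranslatable K q' ∧ cyclicLength T q' ≤ cyclicLength T q := by
  induction hk : n - m generalizing m with
  | zero =>
    obtain rfl : m = n := by omega
    exact ⟨q, hq, le_rfl⟩
  | succ k ih =>
    set x : Fin (m + 2) → EuclideanSpace ℝ (Fin n) :=
      Fin.snoc (α := fun _ => EuclideanSpace ℝ (Fin n)) q (q (Fin.last m)) with hx
    have hxc : ∀ i : Fin (m + 1), x i.castSucc = q i := fun i => by simp [hx]
    have hxl : x (Fin.last (m + 1)) = q (Fin.last m) := by simp [hx]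
    obtain ⟨q', h1, h2⟩ := ih (m := m + 1) (q := x) (by omega)
      (hq.mono fun j => ⟨j.castSucc, hxc j⟩) (by omega)
    refine ⟨q', h1, h2.trans (le_of_eq ?_)⟩
    have h := sum_cyclic_castSucc x fun a b => gauge (polarBody T) (b - a)
    simp only [hxc, hxl, sub_self, gauge_zero, add_zero] at h
    exact add_right_cancel h

theorem NotTranslatable.exists_fin (hK : Convex ℝ K) (hT : IsBody T) {m : ℕ}
    {q : Fin (m + 1) → EuclideanSpace ℝ (Fin n)} (hq : NotTranslatable K q) :
    ∃ q' : Fin (n + 1) → EuclideanSpace ℝ (Fin n),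
      NotTranslatable K q' ∧ cyclicLength T q' ≤ cyclicLength T q :=
  (le_total n m).elim (fun h => hq.exists_of_lt hK hT h) fun h => hq.exists_of_le h

theorem IsBody.exists_notTranslatable (hn : 1 ≤ n) (hK : IsBody K) :
    ∃ q : Fin (n + 1) → EuclideanSpace ℝ (Fin n), NotTranslatable K q := by
  obtain ⟨R, hR⟩ := hK.isCompact.isBounded.exists_norm_le
  have hR0 : 0 ≤ R := (norm_nonneg _).trans (hR 0 hK.zero_mem)
  -- Two points at distance `2 * R + 1` do not fit into a set of norm bound `R`.
  refine ⟨fun i => if i = 0 then 0 else EuclideanSpace.single ⟨0, hn⟩ (2 * R + 1), fun t => ?_⟩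
  by_contra! h
  have h0 := hR _ (interior_subset (h 0))
  have h1 := hR _ (interior_subset (h (Fin.last n)))
  have hl : Fin.last n ≠ 0 := by
    rw [Ne, Fin.ext_iff]; simp; omega
  simp only [if_true, zero_add, hl, if_false] at h0 h1
  have h2 := norm_sub_le (EuclideanSpace.single (⟨0, hn⟩ : Fin n) (2 * R + 1) + t) t
  rw [add_sub_cancel_right, PiLp.norm_single, Real.norm_eq_abs,
    abs_of_nonneg (by positivity)] at h2
  linarith

theorem continuous_cyclicLength (hT : IsBody T) {m : ℕ} :
    Continuous fun q : Fin (m + 1) → EuclideanSpace ℝ (Fin n) => cyclicLength T q :=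
  continuous_finsetSum _ fun _ _ =>
    hT.continuous_gauge_polarBody.comp ((continuous_apply _).sub (continuous_apply _))

theorem norm_sub_zero_le_of_cyclicLength (hT : IsBody T) {r : ℝ} (hr : 0 < r)
    (hrT : Metric.closedBall (0 : EuclideanSpace ℝ (Fin n)) r ⊆ T) {m : ℕ}
    (q : Fin (m + 1) → EuclideanSpace ℝ (Fin n)) (i : Fin (m + 1)) :
    ‖q i - q 0‖ ≤ i * (cyclicLength T q / r) := by
  induction i using Fin.induction with
  | zero => simp
  | succ i ih =>
    have h1 : r * ‖q i.succ - q i.castSucc‖ ≤ cyclicLength T q := by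
      refine (mul_norm_le_gauge_polarBody hT hr.le hrT _).trans ?_
      rw [← Fin.coeSucc_eq_succ]
      exact Finset.single_le_sum (f := fun i => gauge (polarBody T) (q (i + 1) - q i))
        (fun _ _ => gauge_nonneg _) (Finset.mem_univ i.castSucc)
    have h2 : ‖q i.succ - q i.castSucc‖ ≤ cyclicLength T q / r := by
      rwa [le_div_iff₀ hr, mul_comm]
    calc ‖q i.succ - q 0‖ = ‖(q i.succ - q i.castSucc) + (q i.castSucc - q 0)‖ := by
          rw [sub_add_sub_cancel]
      _ ≤ ‖q i.succ - q i.castSucc‖ + ‖q i.castSucc - q 0‖ := norm_add_le _ _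
      _ ≤ cyclicLength T q / r + i.castSucc * (cyclicLength T q / r) := add_le_add h2 ih
      _ = i.succ * (cyclicLength T q / r) := by
          rw [Fin.val_succ, Fin.val_castSucc]; push_cast; ring

theorem cyclicLength_add_const {m : ℕ} (q : Fin (m + 1) → EuclideanSpace ℝ (Fin n))
    (t : EuclideanSpace ℝ (Fin n)) : (cyclicLength T fun i => q i + t) = cyclicLength T q := by
  simp [cyclicLength]

theorem cyclicLength_smul {m : ℕ} (q : Fin (m + 1) → EuclideanSpace ℝ (Fin n)) {c : ℝ}
    (hc : 0 ≤ c) : (cyclicLength T fun i => c • q i) = c * cyclicLength T q := by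
  simp [cyclicLength, ← smul_sub, gauge_smul_of_nonneg hc, Finset.mul_sum]

theorem NotTranslatable.add_const {ι : Type*} {q : ι → EuclideanSpace ℝ (Fin n)}
    (hq : NotTranslatable K q) (t : EuclideanSpace ℝ (Fin n)) :
    NotTranslatable K fun i => q i + t := fun s => by
  obtain ⟨j, hj⟩ := hq (t + s)
  exact ⟨j, by rwa [add_assoc]⟩

/-- The length attains its minimum over the closed polygonal curves that cannot be translated into
the interior of `K`. -/
theorem exists_minimal_notTranslatable (hn : 1 ≤ n) (hK : IsBody K) (hT : IsBody T) :
    ∃ q : Fin (n + 1) → EuclideanSpace ℝ (Fin n), NotTranslatable K q ∧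
      ∀ (m : ℕ) (q' : Fin (m + 1) → EuclideanSpace ℝ (Fin n)), NotTranslatable K q' →
        cyclicLength T q ≤ cyclicLength T q' := by
  obtain ⟨q₀, hq₀⟩ := hK.exists_notTranslatable hn
  obtain ⟨r, hr, hrT⟩ := hT.exists_closedBall_subset
  set M := n * (cyclicLength T q₀ / r)
  -- After a translation taking vertex `0` to the origin, polygons no longer than `q₀` lie in a
  -- fixed ball.
  have hbound : ∀ q : Fin (n + 1) → EuclideanSpace ℝ (Fin n),
      cyclicLength T q ≤ cyclicLength T q₀ → (fun i => q i + -q 0) ∈ Metric.closedBall 0 M := by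
    intro q hq
    have hM : 0 ≤ M := by have := cyclicLength_nonneg (T := T) q₀; positivity
    rw [mem_closedBall_zero_iff, pi_norm_le_iff_of_nonneg hM]
    intro i
    rw [← sub_eq_add_neg]
    refine (norm_sub_zero_le_of_cyclicLength hT hr hrT q i).trans ?_
    have hi : (i : ℝ) ≤ n := by exact_mod_cast Nat.lt_succ_iff.1 i.2
    have := cyclicLength_nonneg (T := T) q
    exact mul_le_mul hi (by gcongr) (by positivity) (by positivity)
  have hcomp : IsCompact ({q : Fin (n + 1) → EuclideanSpace ℝ (Fin n) | NotTranslatable K q} ∩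
      Metric.closedBall 0 M) :=
    (isCompact_closedBall 0 M).inter_left isClosed_notTranslatable
  obtain ⟨q, ⟨hq, -⟩, hmin⟩ := hcomp.exists_isMinOn
    ⟨fun i => q₀ i + -q₀ 0, hq₀.add_const _, hbound q₀ le_rfl⟩
    (continuous_cyclicLength hT).continuousOn
  refine ⟨q, hq, fun m q' hq' => ?_⟩
  obtain ⟨q'', hq'', hle⟩ := hq'.exists_fin hK.convex hT
  refine le_trans ?_ hle
  rw [← cyclicLength_add_const q'' (-q'' 0)]
  by_cases h : cyclicLength T q'' ≤ cyclicLength T q₀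
  · exact hmin ⟨hq''.add_const _, hbound q'' h⟩
  · have := hmin ⟨hq₀.add_const (-q₀ 0), hbound q₀ le_rfl⟩
    simp only [Set.mem_ofPred_eq, cyclicLength_add_const] at this ⊢
    exact this.trans (not_le.1 h).le

end Nontranslatable

/-! ### Existence of minimal billiard trajectories by duality. -/

section Existence

variable {n : ℕ} {K T : Set (EuclideanSpace ℝ (Fin n))}

theorem exists_forall_eq_sum_inner {ι : Type*} [Fintype ι]
    (f : StrongDual ℝ (ι → EuclideanSpace ℝ (Fin n))) :
    ∃ c : ι → EuclideanSpace ℝ (Fin n), ∀ x, f x = ∑ i, inner ℝ (c i) (x i) := by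
  classical
  refine ⟨fun i => (InnerProductSpace.toDual ℝ _).symm
    (f.comp (ContinuousLinearMap.single ℝ (fun _ => EuclideanSpace ℝ (Fin n)) i)), fun x => ?_⟩
  simp only [InnerProductSpace.toDual_symm_apply]
  rw [ContinuousLinearMap.sum_comp_single]

/-- Points of `K` that cannot be translated into the interior of `K` carry outer normals that add
up to zero. -/
theorem NotTranslatable.exists_normals (hK : IsBody K) {ι : Type*} [Fintype ι]
    {q : ι → EuclideanSpace ℝ (Fin n)} (hqK : ∀ i, q i ∈ K) (hq : NotTranslatable K q) :
    ∃ c : ι → EuclideanSpace ℝ (Fin n), (∀ i, c i ∈ normalCone K (q i)) ∧ ∑ i, c i = 0 ∧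
      ∀ a : ι → EuclideanSpace ℝ (Fin n), (∀ i, a i ∈ interior K) →
        ∑ i, inner ℝ (c i) (a i) < ∑ i, inner ℝ (c i) (q i) := by
  classical
  set A : Set (ι → EuclideanSpace ℝ (Fin n)) := Set.univ.pi fun _ => interior K with hA
  set B : Set (ι → EuclideanSpace ℝ (Fin n)) := Set.range fun t i => q i + t with hB
  have hBc : Convex ℝ B := by
    rintro _ ⟨t, rfl⟩ _ ⟨s, rfl⟩ u v - - huv
    refine ⟨u • t + v • s, funext fun i => ?_⟩
    rw [← eq_sub_iff_add_eq] at huv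
    subst huv
    simp only [Pi.add_apply, Pi.smul_apply]
    module
  have hdisj : Disjoint A B := by
    rw [Set.disjoint_left]
    rintro _ h ⟨t, rfl⟩
    obtain ⟨j, hj⟩ := hq t
    exact hj (h j (Set.mem_univ j))
  -- Separates the product of copies of `interior K` from the affine space of translates of `q`.
  -- Varying one coordinate shows that the components of `f` are normals; boundedness below along
  -- the translates makes their sum zero.
  obtain ⟨f, u, hfA, hfB⟩ := geometric_hahn_banach_open
    (convex_pi fun _ _ => hK.convex.interior) (isOpen_set_pi Set.finite_univ
      fun _ _ => isOpen_interior) hBc hdisj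
  obtain ⟨c, hc⟩ := exists_forall_eq_sum_inner f
  have hq0 : u ≤ f q := by simpa using hfB _ ⟨0, rfl⟩
  have hAcl : ∀ a : ι → EuclideanSpace ℝ (Fin n), (∀ i, a i ∈ K) → f a ≤ f q := by
    intro a ha
    have hcl : a ∈ closure A := by
      rw [hA, closure_pi_set]
      intro i _
      rw [hK.convex.closure_interior_eq_closure_of_nonempty_interior ⟨0, hK.zero_mem_interior⟩]
      exact subset_closure (ha i)
    have : closure A ⊆ {a | f a ≤ f q} :=
      closure_minimal (fun a ha => ((hfA a ha).trans_le hq0).le)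
        (isClosed_le f.continuous continuous_const)
    exact this hcl
  refine ⟨c, fun i y hy => ?_, ?_, fun a ha => ?_⟩
  · have h := hAcl (Function.update q i y) fun j => by
      by_cases hj : j = i
      · subst hj; simpa using hy
      · simpa [hj] using hqK j
    rw [← sub_nonpos, ← map_sub, hc, Finset.sum_eq_single i] at h
    · simpa using h
    · intro j _ hj; simp [hj]
    · simp
  · set s := ∑ i, c i with hs
    have hst : ∀ t, f (fun i => q i + t) = f q + inner ℝ s t := fun t => by
      simp only [hc, inner_add_right, Finset.sum_add_distrib, hs, sum_inner]
    have hb : ∀ r : ℝ, u ≤ f q + r * ‖s‖ ^ 2 := fun r => by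
      have := hfB _ ⟨r • s, rfl⟩
      rwa [hst, real_inner_smul_right, real_inner_self_eq_norm_sq] at this
    by_contra hne
    have hs0 : 0 < ‖s‖ ^ 2 := by have := norm_pos_iff.2 hne; positivity
    have := hb ((u - f q - 1) / ‖s‖ ^ 2)
    rw [div_mul_cancel₀ _ hs0.ne'] at this
    linarith
  · rw [← hc, ← hc]
    exact (hfA a fun i _ => ha i).trans_le hq0

/-- Shrinking a minimiser by a factor below `1` makes it strictly shorter, hence translatable into
`K`. Compactness of `K` gives a limit translation as the factor tends to `1`. -/
theorem exists_translate_mem_of_minimal (hK : IsBody K) (hT : IsBody T) {m : ℕ}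
    {q : Fin (m + 1) → EuclideanSpace ℝ (Fin n)} (hq : NotTranslatable K q)
    (hmin : ∀ q' : Fin (m + 1) → EuclideanSpace ℝ (Fin n), NotTranslatable K q' →
      cyclicLength T q ≤ cyclicLength T q') : ∃ t, ∀ i, q i + t ∈ K := by
  have hpos := hq.cyclicLength_pos hK hT
  set c : ℕ → ℝ := fun k => 1 - 1 / ((k : ℝ) + 1) with hc
  have hc1 : ∀ k, c k < 1 := fun k => by
    have : 0 < 1 / ((k : ℝ) + 1) := by positivity
    simp only [hc]; linarith
  have hc0 : ∀ k, 0 ≤ c k := fun k => by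
    have : 1 / ((k : ℝ) + 1) ≤ 1 := by
      rw [div_le_one (by positivity)]
      linarith [(Nat.cast_nonneg k : (0 : ℝ) ≤ k)]
    simp only [hc]; linarith
  have hclim : Tendsto c atTop (𝓝 1) := by
    simpa [hc] using tendsto_const_nhds (x := (1 : ℝ)).sub tendsto_one_div_add_atTop_nhds_zero_nat
  have hex : ∀ k, ∃ t, ∀ i, c k • q i + t ∈ K := fun k => by
    by_contra! h
    have hnt : NotTranslatable K fun i => c k • q i := fun t =>
      (h t).imp fun i hi hi' => hi (interior_subset hi')
    have := hmin _ hnt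
    rw [cyclicLength_smul _ (hc0 k)] at this
    nlinarith [hc1 k]
  choose t ht using hex
  obtain ⟨y, hy, φ, hφ, hlim⟩ := hK.isCompact.tendsto_subseq fun k => ht k 0
  have hcφ := hclim.comp hφ.tendsto_atTop
  have htlim : Tendsto (fun k => t (φ k)) atTop (𝓝 (y - (1 : ℝ) • q 0)) := by
    refine (hlim.sub (hcφ.smul_const (q 0))).congr fun k => ?_
    simp
  refine ⟨y - (1 : ℝ) • q 0, fun i => ?_⟩
  have h2 := (hcφ.smul_const (q i)).add htlim
  rw [one_smul] at h2
  exact hK.isCompact.isClosed.mem_of_tendsto h2 (Eventually.of_forall fun k => ht (φ k) i)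

/-- A linear functional that is dominated by the length comes from points of `T`. -/
theorem exists_dual_points (hT : IsBody T) {m : ℕ} {a : Fin (m + 1) → EuclideanSpace ℝ (Fin n)}
    (ha : ∀ q : Fin (m + 1) → EuclideanSpace ℝ (Fin n),
      ∑ i, inner ℝ (q i) (a i) ≤ cyclicLength T q) :
    ∃ p : Fin (m + 1) → EuclideanSpace ℝ (Fin n), (∀ i, p i ∈ T) ∧
      ∀ i, a (i + 1) = p i - p (i + 1) := by
  set D : (Fin (m + 1) → EuclideanSpace ℝ (Fin n)) →ₗ[ℝ] Fin (m + 1) → EuclideanSpace ℝ (Fin n) :=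
    { toFun := fun p i => p (i - 1) - p i
      map_add' := fun p p' => funext fun i => by simp only [Pi.add_apply]; abel
      map_smul' := fun c p => funext fun i => by simp [smul_sub] }
  have hDi : ∀ p i, D p i = p (i - 1) - p i := fun p i => rfl
  -- The cyclic length is the support function of this compact convex set, so a dominated functional
  -- must belong to it; otherwise separation yields a polygon `c` violating the bound.
  set A := D '' Set.univ.pi fun _ => T with hA
  have hAcl : IsClosed A := by
    refine IsCompact.isClosed ?_
    exact (isCompact_univ_pi fun _ => hT.isCompact).image D.continuous_of_finiteDimensional
  by_cases haA : a ∈ A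
  · obtain ⟨p, hp, rfl⟩ := haA
    exact ⟨p, fun i => hp i (Set.mem_univ i), fun i => by rw [hDi, add_sub_cancel_right]⟩
  have hAcv : Convex ℝ A := (convex_pi fun _ _ => hT.convex).linear_image D
  obtain ⟨f, u, hfA, hfa⟩ := geometric_hahn_banach_closed_point hAcv hAcl haA
  obtain ⟨c, hc⟩ := exists_forall_eq_sum_inner f
  choose p hpT hp using fun i => hT.exists_mem_normalCone (c (i + 1) - c i)
  have h1 := hfA _ ⟨p, fun i _ => hpT i, rfl⟩
  have h2 : f (D p) = cyclicLength T c := by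
    have h3 : cyclicLength T c = ∑ i, inner ℝ (c (i + 1) - c i) (p i) :=
      Finset.sum_congr rfl fun i _ => gauge_polarBody_eq_inner hT.zero_mem (hpT i) (hp i)
    rw [hc, h3, sum_inner_sub_eq, ← Equiv.sum_comp (Equiv.addRight (1 : Fin (m + 1)))]
    simp [hDi]
  have h3 := ha c
  rw [hc] at hfa
  linarith

/-- There is a closed billiard trajectory with at most `n + 1` vertices whose length is minimal
among all closed polygonal curves that cannot be translated into the interior of `K`. -/
theorem exists_minimal_billiard (hn : 1 ≤ n) (hK : IsBody K) (hT : IsBody T) :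
    ∃ k < n, ∃ y : Fin (k + 2) → EuclideanSpace ℝ (Fin n) × EuclideanSpace ℝ (Fin n),
      (∀ i, IsBilliardStep K T (y i) (y (i + 1))) ∧
      (∀ i, (y i).1 ∈ frontier K) ∧
      (∀ i, (y i).1 ∉ segment ℝ (y (i - 1)).1 (y (i + 1)).1) ∧
      (NotTranslatable K fun i => (y i).1) ∧
      ∀ (m : ℕ) (q : Fin (m + 1) → EuclideanSpace ℝ (Fin n)), NotTranslatable K q →
        (cyclicLength T fun i => (y i).1) ≤ cyclicLength T q := by
  obtain ⟨q₀, hq₀, hmin₀⟩ := exists_minimal_notTranslatable hn hK hT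
  obtain ⟨t, ht⟩ := exists_translate_mem_of_minimal hK hT hq₀ (hmin₀ n)
  obtain ⟨q, hqK, hq, hmin⟩ : ∃ q : Fin (n + 1) → EuclideanSpace ℝ (Fin n),
      (∀ i, q i ∈ K) ∧ NotTranslatable K q ∧
      ∀ (m : ℕ) (q' : Fin (m + 1) → EuclideanSpace ℝ (Fin n)), NotTranslatable K q' →
        cyclicLength T q ≤ cyclicLength T q' :=
    ⟨_, ht, hq₀.add_const t, fun m q' h => by
      rw [cyclicLength_add_const]; exact hmin₀ m q' h⟩
  have hpos := hq.cyclicLength_pos hK hT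
  obtain ⟨c, hcN, hc0, hcint⟩ := hq.exists_normals hK hqK
  set C := ∑ i, inner ℝ (c i) (q i) with hC
  have hCpos : 0 < C := by simpa using hcint (fun _ => 0) fun _ => hK.zero_mem_interior
  -- The normals sum to zero, so `∑ i, inner ℝ (c i) (q' i)` is translation invariant, and it is
  -- less than `C` inside the interior.
  have hnt : ∀ q' : Fin (n + 1) → EuclideanSpace ℝ (Fin n),
      ∑ i, inner ℝ (c i) (q' i) = C → NotTranslatable K q' := by
    intro q' hq' t
    by_contra! h
    have := hcint _ h
    simp only [inner_add_right, Finset.sum_add_distrib, ← sum_inner, hc0, inner_zero_left,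
      add_zero, hq'] at this
    exact this.false
  set L := cyclicLength T q with hL
  -- The factor `L / C` makes the functional equal to the length at `q`. Domination follows by
  -- rescaling `q'` to the level `C`, where minimality applies.
  obtain ⟨p, hpT, hp⟩ := exists_dual_points hT (a := fun i => (L / C) • c i) fun q' => by
    simp only [real_inner_smul_right, ← Finset.mul_sum, real_inner_comm (c _)]
    set S := ∑ i, inner ℝ (c i) (q' i) with hS
    rcases le_or_gt S 0 with hS0 | hS0
    · exact (mul_nonpos_of_nonneg_of_nonpos (by positivity) hS0).trans (cyclicLength_nonneg q')
    · have h := hmin n _ (hnt (fun i => (C / S) • q' i) (by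
        simp only [real_inner_smul_right, ← Finset.mul_sum, ← hS]
        exact div_mul_cancel₀ _ hS0.ne'))
      rw [cyclicLength_smul _ (by positivity)] at h
      calc L / C * S ≤ (C / S * cyclicLength T q') / C * S := by gcongr
        _ = cyclicLength T q' := by field_simp
  have hLsum : L = ∑ i, inner ℝ (q (i + 1) - q i) (p i) := by
    have h1 := Equiv.sum_comp (Equiv.addRight (1 : Fin (n + 1)))
      fun i => inner ℝ (q i) ((L / C) • c i)
    simp only [Equiv.coe_addRight, hp] at h1
    rw [sum_inner_sub_eq, h1]
    simp only [real_inner_smul_right, ← Finset.mul_sum, real_inner_comm (c _), ← hC]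
    exact (div_mul_cancel₀ _ hCpos.ne').symm
  -- The termwise inequalities have equal sums, so each is an equality.
  have hpN : ∀ i, inner ℝ (q (i + 1) - q i) (p i) = gauge (polarBody T) (q (i + 1) - q i) := by
    have h := (Finset.sum_eq_sum_iff_of_le
      fun i _ => hT.inner_le_gauge (q (i + 1) - q i) (hpT i)).1 hLsum.symm
    exact fun i => h i (Finset.mem_univ i)
  have hstep : ∀ i, IsBilliardStep K T (q i, p i) (q (i + 1), p (i + 1)) := fun i =>
    { fst_mem := hqK i
      snd_mem := hpT i
      edge := fun y hy => by
        rw [inner_sub_right]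
        exact sub_nonpos.2 ((hT.inner_le_gauge _ hy).trans (hpN i).ge)
      dual_edge := by
        have := smul_mem_normalCone (c := L / C) (by positivity) (hcN (i + 1))
        rwa [hp] at this }
  -- Vertices without reflection go first: the remaining ones carry nonzero normals and so lie on
  -- the boundary. The second deletion only selects among them.
  obtain ⟨k₁, hk₁, x, hx, hxl, hxp⟩ :=
    exists_reflecting_billiard hT (fun i => (q i, p i)) hstep hpos
  obtain ⟨k, hk, y, hy, hyl, -, hym, hyn⟩ :=
    exists_nondegenerate_billiard x hx (hxl ▸ hpos)
  have hlen := hyl.trans hxl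
  refine ⟨k, by omega, y, hy, fun i => ?_, hyn, ?_, fun m q' hq' => ?_⟩
  · obtain ⟨l, hl⟩ := hym i
    rw [hl]
    have h1 := (hx (l - 1)).dual_edge
    rw [sub_add_cancel] at h1
    exact mem_frontier_of_mem_normalCone (hx l).fst_mem h1 (sub_ne_zero.2 (hxp l))
  · exact notTranslatable_of_isBilliardStep hT hy (hlen ▸ hpos)
  · rw [hlen]; exact hmin m q' hq'

end Existence

/-! ### Hausdorff limits of bodies and curves. -/

section Limits

variable {n : ℕ} {K : ℕ → Set (EuclideanSpace ℝ (Fin n))} {K' : Set (EuclideanSpace ℝ (Fin n))}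

theorem hausdorffTendsto_const (A : Set (EuclideanSpace ℝ (Fin n))) :
    HausdorffTendsto (fun _ => A) A := by
  simp [HausdorffTendsto, Metric.hausdorffDist_self_zero]

theorem HausdorffTendsto.comp (h : HausdorffTendsto K K') {φ : ℕ → ℕ} (hφ : StrictMono φ) :
    HausdorffTendsto (fun i => K (φ i)) K' :=
  Tendsto.comp (g := fun i => Metric.hausdorffDist (K i) K') h hφ.tendsto_atTop

theorem HausdorffTendsto.eventually_exists_dist_lt (h : HausdorffTendsto K K')
    (hK : ∀ i, IsBody (K i)) (hK' : IsBody K') {ε : ℝ} (hε : 0 < ε) :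
    ∀ᶠ i in atTop, (∀ x ∈ K i, ∃ y ∈ K', dist x y < ε) ∧ ∀ y ∈ K', ∃ x ∈ K i, dist y x < ε := by
  filter_upwards [Tendsto.eventually_lt_const hε h] with i hi
  have hfin := Metric.hausdorffEDist_ne_top_of_nonempty_of_bounded ⟨0, (hK i).zero_mem⟩
    ⟨0, hK'.zero_mem⟩ (hK i).isCompact.isBounded hK'.isCompact.isBounded
  refine ⟨fun x hx => Metric.exists_dist_lt_of_hausdorffDist_lt hx hi hfin, fun y hy => ?_⟩
  obtain ⟨x, hx, hxy⟩ := Metric.exists_dist_lt_of_hausdorffDist_lt' hy hi hfin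
  exact ⟨x, hx, by rwa [dist_comm]⟩

theorem HausdorffTendsto.exists_norm_le (h : HausdorffTendsto K K')
    (hK : ∀ i, IsBody (K i)) (hK' : IsBody K') :
    ∃ R, ∀ᶠ i in atTop, ∀ x ∈ K i, ‖x‖ ≤ R := by
  obtain ⟨R, hR⟩ := hK'.isCompact.isBounded.exists_norm_le
  refine ⟨R + 1, ?_⟩
  filter_upwards [h.eventually_exists_dist_lt hK hK' one_pos] with i hi x hx
  obtain ⟨y, hy, hxy⟩ := hi.1 x hx
  rw [dist_eq_norm] at hxy
  have := norm_add_le (x - y) y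
  rw [sub_add_cancel] at this
  linarith [hR y hy]

theorem HausdorffTendsto.mem_of_tendsto (h : HausdorffTendsto K K')
    (hK : ∀ i, IsBody (K i)) (hK' : IsBody K') {z : ℕ → EuclideanSpace ℝ (Fin n)}
    {z' : EuclideanSpace ℝ (Fin n)} (hz : Tendsto z atTop (𝓝 z')) (hzK : ∀ i, z i ∈ K i) :
    z' ∈ K' := by
  rw [← hK'.isCompact.isClosed.closure_eq, Metric.mem_closure_iff]
  intro ε hε
  obtain ⟨i, hi, hi'⟩ := ((h.eventually_exists_dist_lt hK hK' (half_pos hε)).and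
    (hz.eventually (Metric.ball_mem_nhds z' (half_pos hε)))).exists
  obtain ⟨y, hy, hzy⟩ := hi.1 _ (hzK i)
  refine ⟨y, hy, ?_⟩
  have := dist_triangle z' (z i) y
  rw [dist_comm] at hi'
  linarith

theorem HausdorffTendsto.exists_tendsto (h : HausdorffTendsto K K')
    (hK : ∀ i, IsBody (K i)) (hK' : IsBody K') {y : EuclideanSpace ℝ (Fin n)} (hy : y ∈ K') :
    ∃ z : ℕ → EuclideanSpace ℝ (Fin n), (∀ i, z i ∈ K i) ∧ Tendsto z atTop (𝓝 y) := by
  choose z hz hzd using fun i =>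
    (hK i).isCompact.exists_infDist_eq_dist ⟨0, (hK i).zero_mem⟩ y
  refine ⟨z, hz, Metric.tendsto_nhds.2 fun ε hε => ?_⟩
  filter_upwards [h.eventually_exists_dist_lt hK hK' hε] with i hi
  obtain ⟨x, hx, hxy⟩ := hi.2 y hy
  rw [dist_comm, ← hzd]
  exact (Metric.infDist_le_dist_of_mem hx).trans_lt hxy

/-- Every point of `K'` is a limit of points of the `K i`, so each defining inequality passes to the
limit. -/
theorem HausdorffTendsto.mem_normalCone_of_tendsto (h : HausdorffTendsto K K')
    (hK : ∀ i, IsBody (K i)) (hK' : IsBody K') {z v : ℕ → EuclideanSpace ℝ (Fin n)}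
    {z' v' : EuclideanSpace ℝ (Fin n)} (hz : Tendsto z atTop (𝓝 z')) (hv : Tendsto v atTop (𝓝 v'))
    (hvz : ∀ i, v i ∈ normalCone (K i) (z i)) : v' ∈ normalCone K' z' := fun y hy => by
  obtain ⟨w, hw, hwy⟩ := h.exists_tendsto hK hK' hy
  exact le_of_tendsto (hv.inner (hwy.sub hz)) (Eventually.of_forall fun i => hvz i _ (hw i))

theorem HausdorffTendsto.eventually_closedBall_subset (h : HausdorffTendsto K K')
    (hK : ∀ i, IsBody (K i)) (hK' : IsBody K') {c : EuclideanSpace ℝ (Fin n)} {r : ℝ} (hr : 0 < r)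
    (hc : Metric.closedBall c r ⊆ K') :
    ∀ᶠ i in atTop, Metric.closedBall c (r / 2) ⊆ K i := by
  filter_upwards [h.eventually_exists_dist_lt hK hK' (half_pos hr)] with i hi x hx
  by_contra hxK
  obtain ⟨f, u, hfK, hfx⟩ := geometric_hahn_banach_closed_point (hK i).convex
    (hK i).isCompact.isClosed hxK
  obtain ⟨v, rfl⟩ := (InnerProductSpace.toDual ℝ (EuclideanSpace ℝ (Fin n))).surjective f
  simp only [InnerProductSpace.toDual_apply_apply] at hfK hfx
  have hv : v ≠ 0 := by
    rintro rfl
    have := hfK 0 (hK i).zero_mem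
    simp only [inner_zero_left] at this hfx
    linarith
  have hv' : 0 < ‖v‖ := norm_pos_iff.2 hv
  -- The extreme point of the large ball in the direction `v` is within `r / 2` of `K i`, which
  -- contradicts separation from a point of the half-radius ball.
  obtain ⟨y, hy, hyd⟩ := hi.2 (c + (r / ‖v‖) • v) (hc <| by
    rw [mem_closedBall_iff_norm, add_sub_cancel_left, norm_smul, Real.norm_eq_abs,
      abs_of_nonneg (by positivity), div_mul_cancel₀ _ hv'.ne'])
  rw [dist_eq_norm] at hyd
  rw [mem_closedBall_iff_norm] at hx
  have h1 := real_inner_le_norm v (x - c)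
  have h2 := real_inner_le_norm v (c + (r / ‖v‖) • v - y)
  have h3 : inner ℝ v ((r / ‖v‖) • v) = r * ‖v‖ := by
    rw [real_inner_smul_right, real_inner_self_eq_norm_sq]; field_simp
  rw [inner_sub_right] at h1
  rw [inner_sub_right, inner_add_right, h3] at h2
  have h4 := hfK y hy
  nlinarith [mul_le_mul_of_nonneg_left hx hv'.le, mul_lt_mul_of_pos_left hyd hv']

theorem HausdorffTendsto.mem_frontier_of_tendsto (h : HausdorffTendsto K K')
    (hK : ∀ i, IsBody (K i)) (hK' : IsBody K') {z : ℕ → EuclideanSpace ℝ (Fin n)}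
    {z' : EuclideanSpace ℝ (Fin n)} (hz : Tendsto z atTop (𝓝 z'))
    (hzK : ∀ i, z i ∈ frontier (K i)) : z' ∈ frontier K' := by
  refine ⟨subset_closure (h.mem_of_tendsto hK hK' hz fun i => (hK i).mem_of_mem_frontier (hzK i)),
    fun hint => ?_⟩
  obtain ⟨r, hr, hrK⟩ :=
    Metric.nhds_basis_closedBall.mem_iff.1 (mem_interior_iff_mem_nhds.1 hint)
  obtain ⟨i, hi, hi'⟩ := ((h.eventually_closedBall_subset hK hK' hr hrK).and
    (hz.eventually (Metric.ball_mem_nhds z' (half_pos hr)))).exists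
  exact (hzK i).2 (interior_mono hi (Metric.ball_subset_interior_closedBall hi'))

/-- A ball of radius `r` about the origin lies in `K'`; a point of `K i` is a point of `K'` plus an
error of norm below `ε * r`, which lies in `ε K'`. -/
theorem HausdorffTendsto.eventually_smul_mem (h : HausdorffTendsto K K')
    (hK : ∀ i, IsBody (K i)) (hK' : IsBody K') {ε : ℝ} (hε : 0 < ε) :
    ∀ᶠ i in atTop, ∀ x ∈ K i, (1 + ε)⁻¹ • x ∈ K' := by
  obtain ⟨r, hr, hrK⟩ := hK'.exists_closedBall_subset
  filter_upwards [h.eventually_exists_dist_lt hK hK' (mul_pos hε hr)] with i hi x hx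
  obtain ⟨y, hy, hxy⟩ := hi.1 x hx
  have h1 : ε⁻¹ • (x - y) ∈ K' := hrK <| by
    rw [mem_closedBall_zero_iff, norm_smul, norm_inv, Real.norm_eq_abs, abs_of_pos hε,
      inv_mul_le_iff₀ hε, ← dist_eq_norm]
    exact hxy.le
  have h2 := hK'.convex hy h1 (a := (1 + ε)⁻¹) (b := (1 + ε)⁻¹ * ε) (by positivity) (by positivity)
    (by field_simp)
  rw [mul_smul, smul_inv_smul₀ hε.ne', ← smul_add, add_sub_cancel] at h2
  exact h2

theorem NotTranslatable.smul {L : Set (EuclideanSpace ℝ (Fin n))} {ι : Type*}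
    {q : ι → EuclideanSpace ℝ (Fin n)} (hq : NotTranslatable K' q) {c : ℝ} (hc : 0 < c)
    (hL : ∀ x ∈ L, c⁻¹ • x ∈ K') : NotTranslatable L fun i => c • q i := fun t => by
  obtain ⟨j, hj⟩ := hq (c⁻¹ • t)
  refine ⟨j, fun hmem => hj ?_⟩
  have h1 : interior L ⊆ (fun x => c⁻¹ • x) ⁻¹' interior K' := by
    have := (Homeomorph.smulOfNeZero (α := EuclideanSpace ℝ (Fin n)) c⁻¹
      (inv_ne_zero hc.ne')).preimage_interior K'
    change (fun x => c⁻¹ • x) ⁻¹' interior K' = interior ((fun x => c⁻¹ • x) ⁻¹' K') at this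
    rw [this]
    exact interior_mono hL
  have h2 : c⁻¹ • (c • q j + t) ∈ interior K' := h1 hmem
  rwa [smul_add, inv_smul_smul₀ hc.ne'] at h2

/-- Support functions are monotone and homogeneous in the body. -/
theorem cyclicLength_le_mul {T T' : Set (EuclideanSpace ℝ (Fin n))} (hT : IsBody T)
    (hT' : IsBody T') {c : ℝ} (hc : 0 < c) (h : ∀ x ∈ T, c⁻¹ • x ∈ T') {m : ℕ}
    (q : Fin (m + 1) → EuclideanSpace ℝ (Fin n)) :
    cyclicLength T q ≤ c * cyclicLength T' q := by
  rw [cyclicLength, cyclicLength, Finset.mul_sum]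
  refine Finset.sum_le_sum fun i _ => ?_
  obtain ⟨y, hy, hv⟩ := hT.exists_mem_normalCone (q (i + 1) - q i)
  rw [gauge_polarBody_eq_inner hT.zero_mem hy hv]
  have := hT'.inner_le_gauge (q (i + 1) - q i) (h y hy)
  rwa [real_inner_smul_right, inv_mul_le_iff₀ hc] at this

theorem hausdorffTendsto_cyclicTrace {m : ℕ} {q : ℕ → Fin (m + 1) → EuclideanSpace ℝ (Fin n)}
    {q' : Fin (m + 1) → EuclideanSpace ℝ (Fin n)} (h : Tendsto q atTop (𝓝 q')) :
    HausdorffTendsto (fun i => cyclicTrace (q i)) (cyclicTrace q') := by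
  have key : ∀ (a b : Fin (m + 1) → EuclideanSpace ℝ (Fin n)), ∀ x ∈ cyclicTrace a,
      ∃ y ∈ cyclicTrace b, dist x y ≤ dist a b := by
    intro a b x hx
    obtain ⟨i, u, v, hu, hv, huv, rfl⟩ := Set.mem_iUnion.1 hx
    refine ⟨u • b i + v • b (i + 1), Set.mem_iUnion.2 ⟨i, u, v, hu, hv, huv, rfl⟩, ?_⟩
    refine (dist_add_add_le _ _ _ _).trans ?_
    rw [dist_smul₀, dist_smul₀, Real.norm_of_nonneg hu, Real.norm_of_nonneg hv]
    calc u * dist (a i) (b i) + v * dist (a (i + 1)) (b (i + 1))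
        ≤ u * dist a b + v * dist a b := by gcongr <;> exact dist_le_pi_dist a b _
      _ = dist a b := by rw [← add_mul, huv, one_mul]
  refine squeeze_zero (fun _ => Metric.hausdorffDist_nonneg) (fun i => ?_)
    (tendsto_iff_dist_tendsto_zero.1 h)
  refine Metric.hausdorffDist_le_of_mem_dist dist_nonneg (key _ _) fun x hx => ?_
  rw [dist_comm]
  exact key _ _ x hx

end Limits

/-! ### Passage to the limit. -/

section Main

variable {n : ℕ}

/-- `ZMod (k + 2)` unfolds to `Fin (k + 2)`, so trace and length agree by `rfl`. Nonzero edges put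
the dual points on the boundary of `T`. -/
theorem exists_closedPolygon {K T : Set (EuclideanSpace ℝ (Fin n))} {k : ℕ}
    {x : Fin (k + 2) → EuclideanSpace ℝ (Fin n) × EuclideanSpace ℝ (Fin n)}
    (hx : ∀ i, IsBilliardStep K T (x i) (x (i + 1))) (hfr : ∀ i, (x i).1 ∈ frontier K)
    (hnd : ∀ i, (x i).1 ∉ segment ℝ (x (i - 1)).1 (x (i + 1)).1) :
    ∃ q : ClosedPolygon n, q.IsBilliard K T ∧ q.trace = (cyclicTrace fun i => (x i).1) ∧
      q.length T = cyclicLength T fun i => (x i).1 := by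
  have hne : ∀ i, (x i).1 ≠ (x (i + 1)).1 := fun i h =>
    hnd i (by rw [h]; exact right_mem_segment _ _ _)
  refine ⟨⟨k + 2, by omega, fun i : Fin (k + 2) => (x i).1, hne, hnd⟩, ⟨hfr,
    fun i : Fin (k + 2) => (x i).2, fun i => ?_, fun i => ⟨(hx i).edge, ?_⟩⟩, rfl, rfl⟩
  · exact mem_frontier_of_mem_normalCone (hx i).snd_mem (hx i).edge (sub_ne_zero.2 (hne i).symm)
  · rw [neg_sub]
    exact (hx i).dual_edge

theorem ClosedPolygon.IsBilliard.exists_steps {K T : Set (EuclideanSpace ℝ (Fin n))}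
    (hK : IsBody K) (hT : IsBody T) {q : ClosedPolygon n} (hq : q.IsBilliard K T) :
    ∃ (m : ℕ) (x : Fin (m + 1) → EuclideanSpace ℝ (Fin n)), NotTranslatable K x ∧
      q.length T = cyclicLength T x := by
  obtain ⟨m, hm, v, hne, hnd⟩ := q
  obtain ⟨m, rfl⟩ : ∃ k, m = k + 1 := ⟨m - 1, by omega⟩
  obtain ⟨hv, p, hp, hvp⟩ := hq
  refine ⟨m, v, ?_, rfl⟩
  refine notTranslatable_of_isBilliardStep (x := fun i => (v i, p i)) hT (fun i =>
    ⟨hK.mem_of_mem_frontier (hv i), hT.mem_of_mem_frontier (hp i), (hvp i).1, ?_⟩)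
    (cyclicLength_pos hT (i := 1) ?_)
  · rw [← neg_sub]
    exact (hvp i).2
  · have := hne 0
    rw [zero_add] at this
    exact this.symm

/-- Minimal billiard trajectories subconverge when both bodies vary. -/
theorem exists_subseq_isMinimizingBilliard (hn : 1 ≤ n)
    {K T : ℕ → Set (EuclideanSpace ℝ (Fin n))} {K' T' : Set (EuclideanSpace ℝ (Fin n))}
    (hK : ∀ i, IsBody (K i)) (hT : ∀ i, IsBody (T i)) (hK' : IsBody K') (hT' : IsBody T')
    (hKlim : HausdorffTendsto K K') (hTlim : HausdorffTendsto T T') :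
    ∃ φ : ℕ → ℕ, StrictMono φ ∧ ∃ q : ℕ → ClosedPolygon n,
      (∀ j, (q j).IsMinimizingBilliard (K (φ j)) (T (φ j))) ∧
      ∃ q' : ClosedPolygon n, q'.IsMinimizingBilliard K' T' ∧
        HausdorffTendsto (fun j => (q j).trace) q'.trace := by
  have hex := fun i => exists_minimal_billiard hn (hK i) (hT i)
  -- Pigeonhole: the vertex numbers take finitely many values, so one occurs infinitely often.
  obtain ⟨k, hk⟩ : ∃ k, ∃ᶠ i in atTop,
      ∃ y : Fin (k + 2) → EuclideanSpace ℝ (Fin n) × EuclideanSpace ℝ (Fin n),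
      (∀ j, IsBilliardStep (K i) (T i) (y j) (y (j + 1))) ∧
      (∀ j, (y j).1 ∈ frontier (K i)) ∧
      (∀ j, (y j).1 ∉ segment ℝ (y (j - 1)).1 (y (j + 1)).1) ∧
      (NotTranslatable (K i) fun j => (y j).1) ∧
      ∀ (m : ℕ) (q : Fin (m + 1) → EuclideanSpace ℝ (Fin n)), NotTranslatable (K i) q →
        (cyclicLength (T i) fun j => (y j).1) ≤ cyclicLength (T i) q := by
    by_contra h
    rw [not_exists] at h
    replace h := fun k => not_frequently.1 (h k)
    obtain ⟨i, hi⟩ := ((eventually_all_finset (Finset.range n)).2 fun k _ => h k).exists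
    obtain ⟨k, hk, hy⟩ := hex i
    exact hi k (Finset.mem_range.2 hk) hy
  obtain ⟨φ, hφ, hφy⟩ := extraction_of_frequently_atTop hk
  choose y hstep hfr hnd hnt hmin using hφy
  obtain ⟨R, hR⟩ := (hKlim.comp hφ).exists_norm_le (fun i => hK _) hK'
  obtain ⟨S, hS⟩ := (hTlim.comp hφ).exists_norm_le (fun i => hT _) hT'
  have hbd : ∀ᶠ i in atTop, y i ∈ Metric.closedBall 0 (max R S) := by
    filter_upwards [hR, hS] with i hRi hSi
    rw [mem_closedBall_zero_iff, pi_norm_le_iff_of_nonempty]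
    exact fun j => max_le_max (hRi _ (hstep i j).fst_mem) (hSi _ (hstep i j).snd_mem)
  obtain ⟨x, -, ψ, hψ, hlim⟩ :=
    (isCompact_closedBall _ _).tendsto_subseq' hbd.frequently
  have hφψ := hφ.comp hψ
  have hKl := hKlim.comp hφψ
  have hTl := hTlim.comp hφψ
  have hlimj : ∀ j, Tendsto (fun i => y (ψ i) j) atTop (𝓝 (x j)) := fun j =>
    (tendsto_pi_nhds.1 hlim) j
  have hlim1 : ∀ j, Tendsto (fun i => (y (ψ i) j).1) atTop (𝓝 (x j).1) := fun j =>
    (continuous_fst.tendsto _).comp (hlimj j)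
  have hlim2 : ∀ j, Tendsto (fun i => (y (ψ i) j).2) atTop (𝓝 (x j).2) := fun j =>
    (continuous_snd.tendsto _).comp (hlimj j)
  have hx : ∀ j, IsBilliardStep K' T' (x j) (x (j + 1)) := fun j =>
    { fst_mem := hKl.mem_of_tendsto (fun _ => hK _) hK' (hlim1 j) fun i => (hstep (ψ i) j).fst_mem
      snd_mem := hTl.mem_of_tendsto (fun _ => hT _) hT' (hlim2 j) fun i => (hstep (ψ i) j).snd_mem
      edge := hTl.mem_normalCone_of_tendsto (fun _ => hT _) hT' (hlim2 j)
        ((hlim1 (j + 1)).sub (hlim1 j)) fun i => (hstep (ψ i) j).edge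
      dual_edge := hKl.mem_normalCone_of_tendsto (fun _ => hK _) hK' (hlim1 (j + 1))
        ((hlim2 j).sub (hlim2 (j + 1))) fun i => (hstep (ψ i) j).dual_edge }
  have hxfr : ∀ j, (x j).1 ∈ frontier K' := fun j =>
    hKl.mem_frontier_of_tendsto (fun _ => hK _) hK' (hlim1 j) fun i => hfr (ψ i) j
  have hpos : 0 < cyclicLength T' fun j => (x j).1 := by
    -- If the polygons shrank to a point, they could be translated into a ball about the origin that
    -- eventually lies in the bodies.
    obtain ⟨j, hj⟩ : ∃ j, (x j).1 ≠ (x 0).1 := by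
      by_contra! h
      obtain ⟨r, hr, hrK⟩ := hK'.exists_closedBall_subset
      have hsmall : ∀ᶠ i in atTop, ∀ j,
          (y (ψ i) j).1 + -(y (ψ i) 0).1 ∈ Metric.ball 0 (r / 2) := by
        refine eventually_all.2 fun j => ?_
        have := (hlim1 j).add (hlim1 0).neg
        rw [h j, add_neg_cancel] at this
        exact this.eventually (Metric.ball_mem_nhds 0 (half_pos hr))
      obtain ⟨i, hi, hi'⟩ :=
        (hsmall.and (hKl.eventually_closedBall_subset (fun _ => hK _) hK' hr hrK)).exists
      obtain ⟨j, hj⟩ := hnt (ψ i) (-(y (ψ i) 0).1)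
      exact hj (interior_mono hi' (Metric.ball_subset_interior_closedBall (hi j)))
    exact cyclicLength_pos hT' hj
  have hlen : Tendsto (fun i => cyclicLength (T (φ (ψ i))) fun j => (y (ψ i) j).1) atTop
      (𝓝 (cyclicLength T' fun j => (x j).1)) := by
    -- Written with the dual points, the length is jointly continuous although the body `T` varies.
    have h1 : (cyclicLength T' fun j => (x j).1) =
        ∑ j, inner ℝ ((x (j + 1)).1 - (x j).1) (x j).2 :=
      Finset.sum_congr rfl fun j _ => (hx j).gauge_eq hT'
    rw [h1]
    refine (tendsto_finsetSum _ fun j _ =>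
      ((hlim1 (j + 1)).sub (hlim1 j)).inner (hlim2 j)).congr fun i => ?_
    exact Finset.sum_congr rfl fun j _ => ((hstep (ψ i) j).gauge_eq (hT _)).symm
  obtain ⟨l, -, z, hz, hzl, hzt, hzm, hznd⟩ := exists_nondegenerate_billiard x hx hpos
  obtain ⟨q', hq'b, hq't, hq'l⟩ := exists_closedPolygon hz
    (fun j => by obtain ⟨s, hs⟩ := hzm j; rw [hs]; exact hxfr s) hznd
  choose q hqb hqt hql using fun i =>
    exists_closedPolygon (hstep (ψ i)) (hfr (ψ i)) (hnd (ψ i))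
  refine ⟨φ ∘ ψ, hφψ, q, fun j => ⟨hqb j, fun q₁ hq₁ => ?_⟩, q', ⟨hq'b, fun q₁ hq₁ => ?_⟩, ?_⟩
  · obtain ⟨m, w, hw, hwl⟩ := hq₁.exists_steps (hK _) (hT _)
    exact (hql j).le.trans ((hmin (ψ j) m w hw).trans hwl.ge)
  · obtain ⟨m, w, hw, hwl⟩ := hq₁.exists_steps hK' hT'
    rw [hq'l, hzl, hwl]
    -- One factor `1 + ε` comes from enlarging the competitor to fit `K i`, the other from comparing
    -- `T i` with `T'`.
    have hε : ∀ ε > 0, (cyclicLength T' fun j => (x j).1) ≤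
        (1 + ε) * ((1 + ε) * cyclicLength T' w) := by
      intro ε hε
      have hε' : 0 < 1 + ε := by positivity
      refine le_of_tendsto hlen ?_
      filter_upwards [hKl.eventually_smul_mem (fun _ => hK _) hK' hε,
        hTl.eventually_smul_mem (fun _ => hT _) hT' hε] with i hiK hiT
      refine (hmin (ψ i) m _ (hw.smul hε' hiK)).trans ?_
      rw [cyclicLength_smul _ hε'.le]
      gcongr
      exact cyclicLength_le_mul (hT _) hT' hε' hiT w
    have hc : Tendsto (fun ε : ℝ => (1 + ε) * ((1 + ε) * cyclicLength T' w)) (𝓝[>] 0)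
        (𝓝 (cyclicLength T' w)) := by
      have : Continuous fun ε : ℝ => (1 + ε) * ((1 + ε) * cyclicLength T' w) := by fun_prop
      simpa using (this.tendsto 0).mono_left nhdsWithin_le_nhds
    exact ge_of_tendsto hc (eventually_mem_nhdsWithin.mono fun ε h => hε ε h)
  · rw [hq't, hzt]
    simp only [hqt]
    exact hausdorffTendsto_cyclicTrace (tendsto_pi_nhds.2 hlim1)

end Main

theorem theorem3p3 (n : ℕ) (hn : 1 ≤ n) :
    (∀ (T : Set (EuclideanSpace ℝ (Fin n))) (K : ℕ → Set (EuclideanSpace ℝ (Fin n)))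
      (K' : Set (EuclideanSpace ℝ (Fin n))),
      IsBody T → StrictConvex ℝ T → (∀ i, IsBody (K i)) → IsBody K' → HausdorffTendsto K K' →
      ∃ φ : ℕ → ℕ, StrictMono φ ∧ ∃ q : ℕ → ClosedPolygon n,
        (∀ j, (q j).IsMinimizingBilliard (K (φ j)) T) ∧
        ∃ q' : ClosedPolygon n, q'.IsMinimizingBilliard K' T ∧
          HausdorffTendsto (fun j => (q j).trace) q'.trace) ∧
    (∀ (K : Set (EuclideanSpace ℝ (Fin n))) (T : ℕ → Set (EuclideanSpace ℝ (Fin n)))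
      (T' : Set (EuclideanSpace ℝ (Fin n))),
      IsBody K → (∀ i, IsBody (T i)) → (∀ i, StrictConvex ℝ (T i)) → IsBody T' →
      HausdorffTendsto T T' →
      ∃ φ : ℕ → ℕ, StrictMono φ ∧ ∃ q : ℕ → ClosedPolygon n,
        (∀ j, (q j).IsMinimizingBilliard K (T (φ j))) ∧
        ∃ q' : ClosedPolygon n, q'.IsMinimizingBilliard K T' ∧
          HausdorffTendsto (fun j => (q j).trace) q'.trace) := by
  constructor
  · intro T K K' hT _ hK hK' hlim
    exact exists_subseq_isMinimizingBilliard hn hK (fun _ => hT) hK' hT hlim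
      (hausdorffTendsto_const T)
  · intro K T T' hK hT _ hT' hlim
    exact exists_subseq_isMinimizingBilliard hn (fun _ => hK) hT hK hT'
      (hausdorffTendsto_const K) hlim
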